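/- Setting. Let $\mathfrak h$ be a real separable Hilbert space, $\mathfrak h_{\mathbb C}$ its complexification with conjugation $x+iy\mapsto\overline{x+iy}=x-iy$ (inner products are antilinear in the first argument), and let $\mathfrak H=\bigoplus_{n\ge0}\mathfrak h_{\mathbb C}^{\odot n}$ be the symmetric Fock space over $\mathfrak h_{\mathbb C}$, with exponential vectors $\mathcal E(f)=\sum_n f^{\otimes n}/\sqrt{n!}$, annihilation operators $a(h)$ and creation operators $a^+(h)$, so that $[a(h),a^+(k)]=\langle h,k\rangle$. Put $Q(h)=a(\overline h)+a^+(h)$ and $P(h)=i\big(a(\overline h)-a^+(h)\big)$ for $h\in\mathfrak h_{\mathbb C}$, and, for $h_1,h_2\in\mathfrak h$, let $U(h_1,h_2)=\exp\big(iP(h_1)+iQ(h_2)\big)$ be the Weyl operator, i.e. the unitary operator with $U(h_1,h_2)\mathcal E(f)=e^{-\langle z,f\rangle-\|z\|^2/2}\,\mathcal E(f+z)$, $z=h_1+ih_2$. For $h=(h_1,h_2)\in\mathfrak h^2$ and a Schwartz function $\varphi$ on $\mathbb R^2$, let $O_h(\varphi)$ be the bounded operator on $\mathfrak H$ with $$\langle\mathcal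 E(f),O_h(\varphi)\mathcal E(g)\rangle=\frac1{2\pi}\int_{\mathbb R^2}\langle\mathcal E(f),U(uh_1,vh_2)\mathcal E(g)\rangle\,\mathcal F^{-1}\varphi(u,v)\,du\,dv\qquad(f,g\in\mathfrak h_{\mathbb C}),$$ where $\mathcal F^{-1}\varphi(u,v)=\frac1{2\pi}\int\varphi(x,y)e^{-i(ux+vy)}\,dx\,dy$. A real-valued function $w$ on $\mathbb R^2$ is a Wigner density of $(P(h_1),Q(h_2))$ in a state $\Phi$ if, for every Schwartz function $\varphi$, $\varphi w$ is integrable and $\int\varphi\, w\,dx\,dy=\Phi(O_h(\varphi))$. For $k=(k_1,k_2)\in\mathfrak h_{\mathbb C}^2$, a bounded operator $B$ on $\mathfrak H$ belongs to $\mathrm{Dom}\,D_k$, with $D_kB=M$, if $M$ is a bounded operator that equals $\frac i2[Q(k_1)-P(k_2),B]$ as a form on exponential vectors: $$\langle\mathcal E(f),M\mathcal E(g)\rangle=\tfrac i2\Big(\big\langle\big(Q(\overline k_1)-P(\overline k_2)\big)\mathcal E(f),B\,\mathcal E(g)\big\rangle-\big\langle\mathcal E(f),B\big(Q(k_1)-P(k_2)\big)\mathcal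 E(g)\big\rangle\Big)\qquad(f,g\in\mathfrak h_{\mathbb C}).$$ Theorem. Let $\kappa\in\mathbb N$ (with $0\in\mathbb N$), let $h=(h_1,h_2)\in\mathfrak h^2$ with $\langle h_1,h_2\rangle\ne0$, and let $\Phi(X)=\mathrm{tr}(\rho X)$ for all bounded operators $X$ on $\mathfrak H$, where $\rho$ is a density matrix (a positive trace class operator with $\mathrm{tr}\,\rho=1$). Suppose that there are $k,\ell\in\mathfrak h_{\mathbb C}^2$ such that $$\det\begin{pmatrix}\langle h_1,k_1\rangle&\langle h_2,k_2\rangle\\ \langle h_1,\ell_1\rangle&\langle h_2,\ell_2\rangle\end{pmatrix}\ne0$$ and such that, for all $\kappa_1,\kappa_2\ge0$ with $\kappa_1+\kappa_2\le\kappa$, $\rho\in\mathrm{Dom}\,D_k^{\kappa_1}D_\ell^{\kappa_2}$ and $\mathrm{tr}\,|D_k^{\kappa_1}D_\ell^{\kappa_2}\rho|<\infty$. Then $(P(h_1),Q(h_2))$ has a Wigner density in the state $\Phi$, and every such Wigner density $w$ lies in $H^{p,\kappa}(\mathbb R^2)$ for all $2\le p\le\infty$: $w\in L^p(\mathbb R^2)$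 and, for all $a+b\le\kappa$, the weak derivative $\partial_x^a\partial_y^b w$ exists and lies in $L^p(\mathbb R^2)$. -/

import Mathlib

open scoped TensorProduct ENNReal InnerProductSpace SchwartzMap
open MeasureTheory

set_option linter.unusedSectionVars false

noncomputable section

universe u

namespace WignerMalliavin

/-! ### Complexification of a real Hilbert space -/

/-- The complexification of a real inner product space `E`: the pair `(x, y)` stands for
`x + i y`. -/
def Cplx (E : Type u) : Type u := E × E

namespace Cplx

variable {E : Type u} [NormedAddCommGroup E] [InnerProductSpace ℝ E]

/-- The vector `x + i y`. -/
def mk (x y : E) : Cplx E := (x, y)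

/-- The real part. -/
def re (z : Cplx E) : E := Prod.fst z

/-- The imaginary part. -/
def im (z : Cplx E) : E := Prod.snd z

theorem ext' {z w : Cplx E} (h₁ : z.re = w.re) (h₂ : z.im = w.im) : z = w := Prod.ext h₁ h₂

instance : AddCommGroup (Cplx E) := inferInstanceAs (AddCommGroup (E × E))

@[simp] theorem re_mk (x y : E) : (mk x y).re = x := rfl
@[simp] theorem im_mk (x y : E) : (mk x y).im = y := rfl
@[simp] theorem re_add (z w : Cplx E) : (z + w).re = z.re + w.re := rfl
@[simp] theorem im_add (z w : Cplx E) : (z + w).im = z.im + w.im := rfl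
@[simp] theorem re_zero : (0 : Cplx E).re = 0 := rfl
@[simp] theorem im_zero : (0 : Cplx E).im = 0 := rfl

/-- `(a + i b)(x + i y) = (a x - b y) + i (a y + b x)`. -/
instance : SMul ℂ (Cplx E) where
  smul c z := mk (c.re • z.re - c.im • z.im) (c.re • z.im + c.im • z.re)

@[simp] theorem re_smul (c : ℂ) (z : Cplx E) : (c • z).re = c.re • z.re - c.im • z.im := rfl
@[simp] theorem im_smul (c : ℂ) (z : Cplx E) : (c • z).im = c.re • z.im + c.im • z.re := rfl

instance : Module ℂ (Cplx E) where
  one_smul z := ext' (by simp) (by simp)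
  mul_smul a b z := by
    apply ext'
    · simp only [re_smul, im_smul, Complex.mul_re, Complex.mul_im]; module
    · simp only [re_smul, im_smul, Complex.mul_re, Complex.mul_im]; module
  smul_zero a := ext' (by simp) (by simp)
  smul_add a z w := by
    apply ext'
    · simp only [re_smul, re_add, im_add]; module
    · simp only [im_smul, re_add, im_add]; module
  add_smul a b z := by
    apply ext'
    · simp only [re_smul, re_add, Complex.add_re, Complex.add_im]; module
    · simp only [im_smul, im_add, Complex.add_re, Complex.add_im]; module
  zero_smul z := ext' (by simp) (by simp)

/-- The sesquilinear extension (antilinear in the first argument) of the real inner product. -/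
@[reducible] def innerCore : InnerProductSpace.Core ℂ (Cplx E) where
  inner z w := ⟨inner ℝ z.re w.re + inner ℝ z.im w.im, inner ℝ z.re w.im - inner ℝ z.im w.re⟩
  conj_inner_symm z w := by
    apply Complex.ext
    · simp [real_inner_comm]
    · simp [real_inner_comm]
  re_inner_nonneg z := by
    show 0 ≤ inner ℝ z.re z.re + inner ℝ z.im z.im
    exact add_nonneg real_inner_self_nonneg real_inner_self_nonneg
  definite z hz := by
    have h : inner ℝ z.re z.re + inner ℝ z.im z.im = 0 := congrArg Complex.re hz
    have h1 : 0 ≤ inner ℝ z.re z.re := real_inner_self_nonneg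
    have h2 : 0 ≤ inner ℝ z.im z.im := real_inner_self_nonneg
    apply ext'
    · exact inner_self_eq_zero.1 (by linarith : inner ℝ z.re z.re = 0)
    · exact inner_self_eq_zero.1 (by linarith : inner ℝ z.im z.im = 0)
  add_left x y z := by
    apply Complex.ext
    · simp only [re_add, im_add, inner_add_left, Complex.add_re]; ring
    · simp only [re_add, im_add, inner_add_left, Complex.add_im]; ring
  smul_left x y r := by
    apply Complex.ext
    · simp only [re_smul, im_smul, inner_add_left, inner_sub_left, real_inner_smul_left,
        Complex.mul_re, Complex.conj_re, Complex.conj_im]; ring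
    · simp only [re_smul, im_smul, inner_add_left, inner_sub_left, real_inner_smul_left,
        Complex.mul_im, Complex.conj_re, Complex.conj_im]; ring

instance : NormedAddCommGroup (Cplx E) := innerCore.toNormedAddCommGroup

instance : InnerProductSpace ℂ (Cplx E) := InnerProductSpace.ofCore innerCore.toCore

theorem inner_def (z w : Cplx E) : inner ℂ z w =
    ⟨inner ℝ z.re w.re + inner ℝ z.im w.im, inner ℝ z.re w.im - inner ℝ z.im w.re⟩ := rfl

/-- The conjugation `x + i y ↦ x - i y`. -/
def conj (z : Cplx E) : Cplx E := mk z.re (-z.im)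

/-- The embedding of the real space as the set of real vectors. -/
def ofReal (x : E) : Cplx E := mk x 0

end Cplx

/-! ### The symmetric Fock space -/

section Fock

/-- A bundled complex inner product space; used only to define tensor powers by recursion. -/
structure BundledInner where
  carrier : Type u
  [normed : NormedAddCommGroup carrier]
  [ips : InnerProductSpace ℂ carrier]

/-- The algebraic tensor powers of `K`, with their inner products
`⟨x₁ ⊗ ⋯ ⊗ xₙ, y₁ ⊗ ⋯ ⊗ yₙ⟩ = ∏ ⟨xᵢ, yᵢ⟩`. The zeroth power is one-dimensional. -/
def tensorPowerAux (K : Type u) [NormedAddCommGroup K] [InnerProductSpace ℂ K] :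
    ℕ → BundledInner.{u}
  | 0 => ⟨EuclideanSpace ℂ PUnit.{u + 1}⟩
  | n + 1 =>
    letI := (tensorPowerAux K n).normed
    letI := (tensorPowerAux K n).ips
    ⟨K ⊗[ℂ] (tensorPowerAux K n).carrier⟩

variable (K : Type u) [NormedAddCommGroup K] [InnerProductSpace ℂ K]

/-- The `n`-th algebraic tensor power. -/
def TPow (n : ℕ) : Type u := (tensorPowerAux K n).carrier

instance (n : ℕ) : NormedAddCommGroup (TPow K n) := (tensorPowerAux K n).normed
instance (n : ℕ) : InnerProductSpace ℂ (TPow K n) := (tensorPowerAux K n).ips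

variable {K}

/-- Left multiplication by a vector, `t ↦ x ⊗ t`. -/
def tensorLeft (x : K) (n : ℕ) : TPow K n →L[ℂ] TPow K (n + 1) :=
  TensorProduct.mkL ℂ K (TPow K n) x

/-- The pure power `f ⊗ ⋯ ⊗ f`. -/
def purePow (f : K) : (n : ℕ) → TPow K n
  | 0 => (EuclideanSpace.single PUnit.unit 1 : EuclideanSpace ℂ PUnit.{u + 1})
  | n + 1 => tensorLeft f n (purePow f n)

variable (K) in
/-- The `n`-th Hilbert space tensor power (completion of the algebraic one). -/
abbrev HPow (n : ℕ) : Type u := UniformSpace.Completion (TPow K n)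

variable (K) in
/-- The `n`-th symmetric Hilbert space tensor power: the closed span of the pure powers. -/
def symSubmodule (n : ℕ) : Submodule ℂ (HPow K n) :=
  (Submodule.span ℂ (Set.range fun f : K => ((purePow f n : TPow K n) : HPow K n))).topologicalClosure

variable (K) in
/-- The `n`-th symmetric Hilbert space tensor power as a Hilbert space. -/
def Sym (n : ℕ) : Type u := symSubmodule K n

instance (n : ℕ) : CompleteSpace (symSubmodule K n) :=
  (Submodule.isClosed_topologicalClosure _).completeSpace_coe

instance (n : ℕ) : NormedAddCommGroup (Sym K n) :=
  inferInstanceAs (NormedAddCommGroup (symSubmodule K n))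
instance (n : ℕ) : InnerProductSpace ℂ (Sym K n) :=
  inferInstanceAs (InnerProductSpace ℂ (symSubmodule K n))
instance (n : ℕ) : CompleteSpace (Sym K n) :=
  inferInstanceAs (CompleteSpace (symSubmodule K n))

/-- The inclusion of the symmetric tensors into all tensors. -/
def symIncl (n : ℕ) : Sym K n →L[ℂ] HPow K n := (symSubmodule K n).subtypeL

/-- The orthogonal projection onto the symmetric tensors (the symmetrizer). -/
def symProj (n : ℕ) : HPow K n →L[ℂ] Sym K n := (symSubmodule K n).orthogonalProjectionOnto

theorem inner_symProj_right {n : ℕ} (x : Sym K n) (y : HPow K n) :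
    inner ℂ x (symProj n y) = inner ℂ (symIncl n x) y :=
  Submodule.inner_orthogonalProjectionOnto_eq_of_mem_left x y

theorem inner_symIncl {n : ℕ} (x y : Sym K n) :
    inner ℂ (symIncl n x) (symIncl n y) = inner ℂ x y := rfl

variable (K) in
/-- The symmetric Fock space, the Hilbert space direct sum of the symmetric tensor powers. -/
abbrev Fock : Type u := lp (fun n : ℕ => Sym K n) 2

/-- The pure power as an element of the symmetric tensor power. -/
def symPow (f : K) (n : ℕ) : Sym K n :=
  ⟨((purePow f n : TPow K n) : HPow K n),
    Submodule.le_topologicalClosure _ (Submodule.subset_span ⟨f, rfl⟩)⟩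

theorem inner_purePow (f g : K) (n : ℕ) :
    inner ℂ (purePow f n) (purePow g n) = (inner ℂ f g) ^ n := by
  induction n with
  | zero =>
    show inner ℂ (EuclideanSpace.single PUnit.unit 1 : EuclideanSpace ℂ PUnit.{u + 1})
      (EuclideanSpace.single PUnit.unit 1) = _
    simp
  | succ n ih =>
    show inner ℂ (f ⊗ₜ[ℂ] purePow f n : K ⊗[ℂ] TPow K n) (g ⊗ₜ[ℂ] purePow g n) = _
    rw [TensorProduct.inner_tmul, ih, pow_succ']

theorem inner_symPow (f g : K) (n : ℕ) :
    inner ℂ (symPow f n) (symPow g n) = (inner ℂ f g) ^ n := by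
  rw [← inner_purePow]
  exact UniformSpace.Completion.inner_coe _ _

theorem norm_symPow (f : K) (n : ℕ) : ‖symPow f n‖ = ‖f‖ ^ n := by
  have h : ‖symPow f n‖ ^ 2 = (‖f‖ ^ n) ^ 2 := by
    have h1 := (inner_self_eq_norm_sq_to_K (𝕜 := ℂ) (symPow f n)).symm.trans (inner_symPow f f n)
    rw [inner_self_eq_norm_sq_to_K] at h1
    have h2 : ((‖symPow f n‖ ^ 2 : ℝ) : ℂ) = (((‖f‖ ^ n) ^ 2 : ℝ) : ℂ) := by
      push_cast
      rw [pow_right_comm]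
      exact h1
    exact_mod_cast h2
  exact (sq_eq_sq₀ (norm_nonneg _) (by positivity)).1 h

theorem memℓp_two_iff {G : ℕ → Type u} [∀ n, NormedAddCommGroup (G n)] (x : ∀ n, G n) :
    Memℓp x 2 ↔ Summable fun n => ‖x n‖ ^ 2 := by
  rw [memℓp_gen_iff (by norm_num)]
  simp

theorem expVec_memℓp (f : K) :
    Memℓp (fun n : ℕ => (((Real.sqrt n.factorial)⁻¹ : ℝ) : ℂ) • symPow f n) 2 := by
  rw [memℓp_two_iff]
  refine (Real.summable_pow_div_factorial (‖f‖ ^ 2)).congr fun n => ?_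
  rw [norm_smul, norm_symPow, mul_pow, Complex.norm_real, Real.norm_eq_abs, sq_abs, inv_pow,
    Real.sq_sqrt (by positivity)]
  field_simp
  ring

/-- The exponential vector `∑ₙ f^{⊗ n} / √(n!)`. -/
def expVec (f : K) : Fock K :=
  ⟨fun n : ℕ => (((Real.sqrt n.factorial)⁻¹ : ℝ) : ℂ) • symPow f n, expVec_memℓp f⟩

/-- The creation operator from `n` to `n + 1` particles, `ψ ↦ √(n+1) S(h ⊗ ψ)`, where the
symmetrizer `S` is the orthogonal projection onto the symmetric tensors. -/
def creLevel (h : K) (n : ℕ) : Sym K n →L[ℂ] Sym K (n + 1) :=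
  ((Real.sqrt (n + 1) : ℝ) : ℂ) •
    (symProj (n + 1) ∘L (tensorLeft h n).completion ∘L symIncl n)

/-- The annihilation operator from `n + 1` to `n` particles. -/
def annLevel (h : K) (n : ℕ) : Sym K (n + 1) →L[ℂ] Sym K n :=
  ContinuousLinearMap.adjoint (creLevel h n)

theorem coe_purePow_succ (f : K) (n : ℕ) :
    ((purePow f (n + 1) : TPow K (n + 1)) : HPow K (n + 1)) =
      (tensorLeft f n).completion ((purePow f n : TPow K n) : HPow K n) := by
  rw [ContinuousLinearMap.completion_apply_coe]
  rfl

theorem inner_tensorLeft (x y : K) (n : ℕ) (s t : TPow K n) :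
    inner ℂ (tensorLeft x n s) (tensorLeft y n t) = inner ℂ x y * inner ℂ s t :=
  TensorProduct.inner_tmul (𝕜 := ℂ) (E := K) (F := TPow K n) x y s t

theorem symIncl_symPow (f : K) (n : ℕ) :
    symIncl n (symPow f n) = ((purePow f n : TPow K n) : HPow K n) := rfl

theorem inner_creLevel_symPow (h f g : K) (n : ℕ) :
    inner ℂ (symPow f (n + 1)) (creLevel h n (symPow g n)) =
      ((Real.sqrt (n + 1) : ℝ) : ℂ) * (inner ℂ f h * inner ℂ f g ^ n) := by
  simp only [creLevel, smul_apply, ContinuousLinearMap.comp_apply, inner_smul_right,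
    inner_symProj_right, symIncl_symPow, ContinuousLinearMap.completion_apply_coe,
    UniformSpace.Completion.inner_coe]
  rw [← inner_purePow f g, ← inner_tensorLeft]
  rfl

/-- Symmetric tensors are determined by their inner products with pure powers. -/
theorem sym_ext {n : ℕ} {x y : Sym K n}
    (h : ∀ g : K, inner ℂ x (symPow g n) = inner ℂ y (symPow g n)) : x = y := by
  rw [← sub_eq_zero, ← inner_self_eq_zero (𝕜 := ℂ)]
  have key : ∀ z ∈ symSubmodule K n, inner ℂ (symIncl n (x - y)) z = 0 := by
    intro z hz
    have hcl : IsClosed {z : HPow K n | inner ℂ (symIncl n (x - y)) z = 0} :=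
      isClosed_eq (by fun_prop) continuous_const
    refine closure_minimal (s := (Submodule.span ℂ (Set.range fun f : K =>
      ((purePow f n : TPow K n) : HPow K n)) : Set (HPow K n))) ?_ hcl hz
    intro w hw
    show inner ℂ (symIncl n (x - y)) w = 0
    induction hw using Submodule.span_induction with
    | mem w hw =>
      obtain ⟨g, rfl⟩ := hw
      show inner ℂ (symIncl n (x - y)) (symIncl n (symPow g n)) = 0
      rw [inner_symIncl, inner_sub_left, h g, sub_self]
    | zero => exact inner_zero_right _
    | add a b _ _ ha hb => rw [inner_add_right, ha, hb, add_zero]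
    | smul c a _ ha => rw [inner_smul_right, ha, mul_zero]
  exact key _ (x - y).2

theorem annLevel_symPow (h f : K) (n : ℕ) :
    annLevel h n (symPow f (n + 1)) =
      (((Real.sqrt (n + 1) : ℝ) : ℂ) * inner ℂ h f) • symPow f n := by
  apply sym_ext
  intro g
  rw [annLevel, ContinuousLinearMap.adjoint_inner_left, inner_creLevel_symPow, inner_smul_left,
    inner_symPow]
  simp
  ring

theorem norm_creLevel_le (h : K) (n : ℕ) : ‖creLevel h n‖ ≤ Real.sqrt (n + 1) * ‖h‖ := by
  have h1 : ‖tensorLeft h n‖ ≤ ‖h‖ := by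
    refine ContinuousLinearMap.opNorm_le_bound _ (norm_nonneg _) fun t => ?_
    exact le_of_eq (TensorProduct.norm_tmul (𝕜 := ℂ) (E := K) (F := TPow K n) h t)
  have h2 : ∀ x, ‖(tensorLeft h n).completion x‖ ≤ ‖h‖ * ‖x‖ := by
    intro x
    induction x using UniformSpace.Completion.induction_on with
    | hp => exact isClosed_le (by fun_prop) (by fun_prop)
    | ih a =>
      rw [ContinuousLinearMap.completion_apply_coe, UniformSpace.Completion.norm_coe,
        UniformSpace.Completion.norm_coe]
      exact (tensorLeft h n).le_of_opNorm_le h1 a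
  refine ContinuousLinearMap.opNorm_le_bound _ (by positivity) fun x => ?_
  simp only [creLevel, smul_apply, ContinuousLinearMap.comp_apply, norm_smul,
    Complex.norm_real, Real.norm_eq_abs, abs_of_nonneg (Real.sqrt_nonneg _)]
  rw [mul_assoc]
  gcongr
  calc ‖symProj (n + 1) ((tensorLeft h n).completion (symIncl n x))‖
      ≤ ‖(tensorLeft h n).completion (symIncl n x)‖ :=
        Submodule.norm_orthogonalProjectionOnto_apply_le _ _
    _ ≤ ‖h‖ * ‖symIncl n x‖ := h2 _
    _ = ‖h‖ * ‖x‖ := rfl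

/-- The sequence of components of `a(h) ψ`. -/
def annSeq (h : K) (ψ : Fock K) (n : ℕ) : Sym K n := annLevel h n (ψ (n + 1))

theorem annSeq_add (h : K) (a b : Fock K) : annSeq h (a + b) = annSeq h a + annSeq h b := by
  funext n
  simp [annSeq]

theorem annSeq_smul (h : K) (c : ℂ) (a : Fock K) : annSeq h (c • a) = c • annSeq h a := by
  funext n
  simp [annSeq]

/-- The annihilation operator `a(h)`, on its maximal domain. -/
def annihilation (h : K) : Fock K →ₗ.[ℂ] Fock K where
  domain :=
    { carrier := {ψ | Memℓp (annSeq h ψ) 2}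
      add_mem' := fun {a b} ha hb => by
        show Memℓp _ 2
        rw [annSeq_add]
        exact Memℓp.add ha hb
      zero_mem' := by
        have : annSeq h (0 : Fock K) = 0 := by
          funext n; simp [annSeq]
        show Memℓp _ 2
        rw [this]
        exact zero_memℓp
      smul_mem' := fun c a ha => by
        show Memℓp _ 2
        rw [annSeq_smul]
        exact Memℓp.const_smul ha c }
  toFun :=
    { toFun := fun ψ => ⟨annSeq h ψ, ψ.2⟩
      map_add' := fun a b => by
        apply Subtype.ext
        exact annSeq_add h a b
      map_smul' := fun c a => by
        apply Subtype.ext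
        exact annSeq_smul h c a }

/-- The sequence of components of `a⁺(h) ψ`. -/
def creSeq (h : K) (ψ : Fock K) : (n : ℕ) → Sym K n
  | 0 => 0
  | n + 1 => creLevel h n (ψ n)

theorem creSeq_add (h : K) (a b : Fock K) : creSeq h (a + b) = creSeq h a + creSeq h b := by
  funext n
  cases n <;> simp [creSeq]

theorem creSeq_smul (h : K) (c : ℂ) (a : Fock K) : creSeq h (c • a) = c • creSeq h a := by
  funext n
  cases n <;> simp [creSeq]

/-- The creation operator `a⁺(h)`, on its maximal domain. -/
def creation (h : K) : Fock K →ₗ.[ℂ] Fock K where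
  domain :=
    { carrier := {ψ | Memℓp (creSeq h ψ) 2}
      add_mem' := fun {a b} ha hb => by
        show Memℓp _ 2
        rw [creSeq_add]
        exact Memℓp.add ha hb
      zero_mem' := by
        have : creSeq h (0 : Fock K) = 0 := by
          funext n; cases n <;> simp [creSeq]
        show Memℓp _ 2
        rw [this]
        exact zero_memℓp
      smul_mem' := fun c a ha => by
        show Memℓp _ 2
        rw [creSeq_smul]
        exact Memℓp.const_smul ha c }
  toFun :=
    { toFun := fun ψ => ⟨creSeq h ψ, ψ.2⟩
      map_add' := fun a b => by
        apply Subtype.ext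
        exact creSeq_add h a b
      map_smul' := fun c a => by
        apply Subtype.ext
        exact creSeq_smul h c a }

theorem sqrt_factorial_succ (n : ℕ) :
    (Real.sqrt (n + 1).factorial)⁻¹ * Real.sqrt (n + 1) = (Real.sqrt n.factorial)⁻¹ := by
  rw [Nat.factorial_succ, Nat.cast_mul, Real.sqrt_mul (by positivity)]
  have h1 : Real.sqrt ((n + 1 : ℕ) : ℝ) ≠ 0 := by positivity
  push_cast at h1 ⊢
  field_simp

theorem annSeq_expVec (h f : K) : annSeq h (expVec f) = (inner ℂ h f : ℂ) • expVec f := by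
  funext n
  show annLevel h n ((((Real.sqrt (n + 1).factorial)⁻¹ : ℝ) : ℂ) • symPow f (n + 1)) =
    (inner ℂ h f : ℂ) • (((Real.sqrt n.factorial)⁻¹ : ℝ) : ℂ) • symPow f n
  have h1 := sqrt_factorial_succ n
  rw [map_smul, annLevel_symPow, smul_smul, smul_smul, ← h1, Complex.ofReal_mul]
  congr 1
  ring

theorem expVec_mem_annihilation (h f : K) : expVec f ∈ (annihilation h).domain := by
  show Memℓp _ 2
  rw [annSeq_expVec]
  exact Memℓp.const_smul (expVec f).2 _

theorem expVec_mem_creation (h f : K) : expVec f ∈ (creation h).domain := by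
  show Memℓp _ 2
  rw [memℓp_two_iff, ← summable_nat_add_iff 1]
  have hs : Summable fun n : ℕ => ‖h‖ ^ 2 * (((n : ℝ) + 1) * ((‖f‖ ^ 2) ^ n / n.factorial)) := by
    refine Summable.mul_left _ ?_
    have h1 := Real.summable_pow_div_factorial (‖f‖ ^ 2)
    have h2 : Summable fun n : ℕ => (n : ℝ) * ((‖f‖ ^ 2) ^ n / n.factorial) := by
      rw [← summable_nat_add_iff 1]
      refine (h1.mul_left (‖f‖ ^ 2)).congr fun n => ?_
      rw [Nat.factorial_succ]
      push_cast
      field_simp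
      ring
    refine (h2.add h1).congr fun n => by ring
  refine Summable.of_nonneg_of_le (fun n => by positivity) (fun n => ?_) hs
  show ‖creLevel h n ((((Real.sqrt n.factorial)⁻¹ : ℝ) : ℂ) • symPow f n)‖ ^ 2 ≤ _
  have h3 : ‖creLevel h n ((((Real.sqrt n.factorial)⁻¹ : ℝ) : ℂ) • symPow f n)‖ ≤
      (Real.sqrt (n + 1) * ‖h‖) * ((Real.sqrt n.factorial)⁻¹ * ‖f‖ ^ n) := by
    refine (ContinuousLinearMap.le_of_opNorm_le _ (norm_creLevel_le h n) _).trans (le_of_eq ?_)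
    rw [norm_smul, norm_symPow, Complex.norm_real, Real.norm_eq_abs, abs_of_nonneg (by positivity)]
  refine (pow_le_pow_left₀ (norm_nonneg _) h3 2).trans (le_of_eq ?_)
  rw [mul_pow, mul_pow, mul_pow, inv_pow, Real.sq_sqrt (by positivity), Real.sq_sqrt (by positivity)]
  field_simp
  ring

theorem inner_expVec (f g : K) : inner ℂ (expVec f) (expVec g) = Complex.exp (inner ℂ f g) := by
  rw [lp.inner_eq_tsum, Complex.exp_eq_exp_ℂ, NormedSpace.exp_eq_tsum_div]
  refine tsum_congr fun n => ?_
  show inner ℂ ((((Real.sqrt n.factorial)⁻¹ : ℝ) : ℂ) • symPow f n)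
    ((((Real.sqrt n.factorial)⁻¹ : ℝ) : ℂ) • symPow g n) = _
  rw [inner_smul_left, inner_smul_right, inner_symPow, Complex.conj_ofReal, ← mul_assoc,
    ← Complex.ofReal_mul, ← mul_inv, Real.mul_self_sqrt (by positivity)]
  push_cast
  rw [div_eq_inv_mul]

theorem inner_expVec_creation (h f g : K) :
    inner ℂ (expVec g) (creation h ⟨expVec f, expVec_mem_creation h f⟩) =
      inner ℂ g h * Complex.exp (inner ℂ g f) := by
  rw [lp.inner_eq_tsum]
  have h0 : ∀ n, inner ℂ (expVec g n) (creSeq h (expVec f) n) =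
      match n with
      | 0 => 0
      | n + 1 => inner ℂ g h * ((inner ℂ g f) ^ n / (n.factorial : ℂ)) := by
    intro n
    cases n with
    | zero => exact inner_zero_right _
    | succ n =>
      show inner ℂ ((((Real.sqrt (n + 1).factorial)⁻¹ : ℝ) : ℂ) • symPow g (n + 1))
        (creLevel h n ((((Real.sqrt n.factorial)⁻¹ : ℝ) : ℂ) • symPow f n)) = _
      rw [map_smul, inner_smul_left, inner_smul_right, inner_creLevel_symPow, Complex.conj_ofReal]
      have h1 : (((Real.sqrt (n + 1).factorial)⁻¹ : ℝ) : ℂ) * ((((Real.sqrt n.factorial)⁻¹ : ℝ) : ℂ) *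
          ((Real.sqrt (n + 1) : ℝ) : ℂ)) = ((n.factorial : ℂ))⁻¹ := by
        rw [← Complex.ofReal_mul, ← Complex.ofReal_mul, mul_left_comm, sqrt_factorial_succ,
          ← mul_inv, Real.mul_self_sqrt (by positivity)]
        push_cast
        rfl
      linear_combination (inner ℂ g h * inner ℂ g f ^ n) * h1
  have h2 : HasSum (fun n => inner ℂ (expVec g n) (creSeq h (expVec f) n))
      (inner ℂ g h * Complex.exp (inner ℂ g f)) := by
    rw [← hasSum_nat_add_iff' 1]
    simp only [h0, Finset.range_one, Finset.sum_singleton, sub_zero]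
    refine HasSum.mul_left _ ?_
    rw [Complex.exp_eq_exp_ℂ]
    exact NormedSpace.expSeries_div_hasSum_exp _
  exact h2.tsum_eq

theorem purePow_smul (c : ℂ) (f : K) (n : ℕ) : purePow (c • f) n = c ^ n • purePow f n := by
  induction n with
  | zero => rw [pow_zero, one_smul]; rfl
  | succ n ih =>
    show ((c • f) ⊗ₜ[ℂ] purePow (c • f) n : K ⊗[ℂ] TPow K n) = c ^ (n + 1) • (f ⊗ₜ[ℂ] purePow f n)
    rw [ih, TensorProduct.smul_tmul_smul, pow_succ']

theorem symPow_smul (c : ℂ) (f : K) (n : ℕ) : symPow (c • f) n = c ^ n • symPow f n := by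
  apply Subtype.ext
  show ((purePow (c • f) n : TPow K n) : HPow K n) = c ^ n • ((purePow f n : TPow K n) : HPow K n)
  rw [purePow_smul, UniformSpace.Completion.coe_smul]

/-- A vector orthogonal to all exponential vectors vanishes. -/
theorem eq_zero_of_inner_expVec {ψ : Fock K} (hψ : ∀ f : K, inner ℂ ψ (expVec f) = 0) : ψ = 0 := by
  apply Subtype.ext
  funext n
  apply sym_ext
  intro f
  rw [show (0 : Fock K).1 n = 0 from rfl, inner_zero_left]
  let c : ℕ → ℂ := fun n => (((Real.sqrt n.factorial)⁻¹ : ℝ) : ℂ) * inner ℂ (ψ n) (symPow f n)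
  let p : FormalMultilinearSeries ℂ ℂ ℂ := fun n => ContinuousMultilinearMap.mkPiRing ℂ (Fin n) (c n)
  have hp : HasFPowerSeriesAt (0 : ℂ → ℂ) p 0 := by
    rw [hasFPowerSeriesAt_iff]
    refine Filter.Eventually.of_forall fun z => ?_
    have h1 := lp.hasSum_inner (𝕜 := ℂ) ψ (expVec (z • f))
    rw [hψ] at h1
    refine Eq.mp (congrArg (fun F : ℕ → ℂ => HasSum F 0) (funext fun m => ?_)) h1
    show inner ℂ (ψ m) ((((Real.sqrt m.factorial)⁻¹ : ℝ) : ℂ) • symPow (z • f) m) = _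
    have h2 : p.coeff m = c m := by
      simp [p, FormalMultilinearSeries.coeff]
    rw [h2, symPow_smul, inner_smul_right, inner_smul_right, smul_eq_mul]
    ring
  have h3 : p.coeff n = 0 := by rw [hp.eq_zero]; rfl
  have h4 : c n = 0 := by
    simpa [p, FormalMultilinearSeries.coeff] using h3
  rcases mul_eq_zero.1 h4 with h5 | h5
  · exfalso
    have : (Real.sqrt n.factorial)⁻¹ ≠ 0 := by positivity
    exact this (by exact_mod_cast h5)
  · exact h5

theorem denseRange_expVec :
    DenseRange (Finsupp.linearCombination ℂ (expVec : K → Fock K)) := by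
  have h1 : (Submodule.span ℂ (Set.range (expVec : K → Fock K))).topologicalClosure = ⊤ := by
    rw [Submodule.topologicalClosure_eq_top_iff, Submodule.eq_bot_iff]
    intro ψ hψ
    refine eq_zero_of_inner_expVec fun f => ?_
    exact (Submodule.mem_orthogonal' _ _).1 hψ _ (Submodule.subset_span ⟨f, rfl⟩)
  have h2 : Dense ((Submodule.span ℂ (Set.range (expVec : K → Fock K)) : Submodule ℂ (Fock K)) :
      Set (Fock K)) :=
    Submodule.dense_iff_topologicalClosure_eq_top.2 h1
  rw [← Finsupp.range_linearCombination] at h2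
  exact h2

end Fock

/-! ### Position, momentum and Weyl operators -/

section Operators

variable {E : Type u} [NormedAddCommGroup E] [InnerProductSpace ℝ E]

variable (E) in
/-- The bounded operators on the symmetric Fock space over the complexification of `E`. -/
abbrev BddOp : Type u := Fock (Cplx E) →L[ℂ] Fock (Cplx E)

/-- The position operator `Q(h) = a(h̄) + a⁺(h)`. -/
def position (h : Cplx E) : Fock (Cplx E) →ₗ.[ℂ] Fock (Cplx E) :=
  annihilation h.conj + creation h

/-- The momentum operator `P(h) = i (a(h̄) - a⁺(h))`. -/
def momentum (h : Cplx E) : Fock (Cplx E) →ₗ.[ℂ] Fock (Cplx E) :=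
  Complex.I • (annihilation h.conj - creation h)

theorem expVec_mem_position (h f : Cplx E) : expVec f ∈ (position h).domain :=
  ⟨expVec_mem_annihilation _ f, expVec_mem_creation h f⟩

theorem expVec_mem_momentum (h f : Cplx E) : expVec f ∈ (momentum h).domain :=
  ⟨expVec_mem_annihilation _ f, expVec_mem_creation h f⟩

/-- The vector `Q(h) 𝓔(f)`. -/
def positionExp (h f : Cplx E) : Fock (Cplx E) := position h ⟨expVec f, expVec_mem_position h f⟩

/-- The vector `P(h) 𝓔(f)`. -/
def momentumExp (h f : Cplx E) : Fock (Cplx E) := momentum h ⟨expVec f, expVec_mem_momentum h f⟩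

/-- For `z = h₁ + i h₂`, the vector `exp(-⟨z, f⟩ - ‖z‖² / 2) 𝓔(f + z)`, the image of `𝓔(f)` under
the Weyl operator `U(h₁, h₂)`. -/
def weylExp (z f : Cplx E) : Fock (Cplx E) :=
  Complex.exp (-inner ℂ z f - (‖z‖ : ℂ) ^ 2 / 2) • expVec (f + z)

/-- The Weyl operator `U(h₁, h₂) = exp(i P(h₁) + i Q(h₂))` for real `h₁, h₂`: the bounded operator
whose values on the (total) exponential vectors are given by `weylExp`; see `weyl_expVec` and
`weyl_generator`. -/
def weyl (h₁ h₂ : E) : BddOp E :=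
  LinearMap.extendOfNorm (Finsupp.linearCombination ℂ (weylExp (Cplx.mk h₁ h₂)))
    (Finsupp.linearCombination ℂ expVec)

theorem inner_weylExp (z f g : Cplx E) :
    inner ℂ (weylExp z f) (weylExp z g) = inner ℂ (expVec f) (expVec g) := by
  rw [weylExp, weylExp, inner_smul_left, inner_smul_right, inner_expVec, inner_expVec,
    ← Complex.exp_conj, ← Complex.exp_add, ← Complex.exp_add]
  congr 1
  simp only [inner_add_left, inner_add_right, map_sub, map_neg, inner_conj_symm, map_div₀, map_pow,
    Complex.conj_ofReal, map_ofNat]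
  rw [inner_self_eq_norm_sq_to_K (𝕜 := ℂ) z]
  simp only [Complex.coe_algebraMap]
  ring

theorem norm_weyl_comb (z : Cplx E) (c : Cplx E →₀ ℂ) :
    ‖Finsupp.linearCombination ℂ (weylExp z) c‖ = ‖Finsupp.linearCombination ℂ expVec c‖ := by
  have h : inner ℂ (Finsupp.linearCombination ℂ (weylExp z) c)
      (Finsupp.linearCombination ℂ (weylExp z) c) =
      inner ℂ (Finsupp.linearCombination ℂ (expVec (K := Cplx E)) c)
        (Finsupp.linearCombination ℂ expVec c) := by
    simp only [Finsupp.linearCombination_apply, Finsupp.sum, sum_inner, inner_sum,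
      inner_smul_left, inner_smul_right, inner_weylExp]
  rw [@norm_eq_sqrt_re_inner ℂ, @norm_eq_sqrt_re_inner ℂ, h]

theorem weyl_expVec (h₁ h₂ : E) (f : Cplx E) :
    weyl h₁ h₂ (expVec f) = weylExp (Cplx.mk h₁ h₂) f := by
  have h := LinearMap.extendOfNorm_eq
    (f := Finsupp.linearCombination ℂ (weylExp (Cplx.mk h₁ h₂)))
    (e := Finsupp.linearCombination ℂ (expVec (K := Cplx E)))
    denseRange_expVec ⟨1, fun x => by rw [norm_weyl_comb, one_mul]⟩ (Finsupp.single f 1)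
  simp only [Finsupp.linearCombination_single, one_smul] at h
  exact h

theorem Cplx.conj_ofReal (x : E) : (Cplx.ofReal x).conj = Cplx.ofReal x :=
  Cplx.ext' rfl (neg_zero)

theorem annihilation_expVec (h f : Cplx E) :
    annihilation h ⟨expVec f, expVec_mem_annihilation h f⟩ = (inner ℂ h f : ℂ) • expVec f :=
  Subtype.ext (annSeq_expVec h f)

/-- In the weak sense on exponential vectors, the generator of `t ↦ U(t h₁, t h₂)` is
`i P(h₁) + i Q(h₂)`. -/
theorem weyl_generator (h₁ h₂ : E) (f g : Cplx E) :
    HasDerivAt (fun t : ℝ => inner ℂ (expVec g) (weyl (t • h₁) (t • h₂) (expVec f)))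
      (inner ℂ (expVec g) (Complex.I • momentumExp (Cplx.ofReal h₁) f +
        Complex.I • positionExp (Cplx.ofReal h₂) f)) 0 := by
  set z := Cplx.mk h₁ h₂ with hz
  have hzr : z = Cplx.ofReal h₁ + Complex.I • Cplx.ofReal h₂ :=
    Cplx.ext' (by simp [hz, Cplx.ofReal]) (by simp [hz, Cplx.ofReal])
  have h1 : ∀ t : ℝ, inner ℂ (expVec g) (weyl (t • h₁) (t • h₂) (expVec f)) =
      Complex.exp (-((t : ℂ) * inner ℂ z f) - (t : ℂ) ^ 2 * ((‖z‖ : ℂ) ^ 2 / 2) +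
        (inner ℂ g f + (t : ℂ) * inner ℂ g z)) := by
    intro t
    have ht : Cplx.mk (t • h₁) (t • h₂) = (t : ℂ) • z :=
      Cplx.ext' (by rw [Cplx.re_smul]; simp [hz]) (by rw [Cplx.im_smul]; simp [hz])
    rw [weyl_expVec, ht, weylExp, inner_smul_right, inner_expVec, ← Complex.exp_add, inner_add_right,
      inner_smul_left, inner_smul_right, norm_smul, Complex.conj_ofReal, Complex.norm_real,
      Complex.ofReal_mul, mul_pow, Real.norm_eq_abs, ← Complex.ofReal_pow, sq_abs]
    congr 1
    push_cast
    ring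
  have h2 : inner ℂ (expVec g) (Complex.I • momentumExp (Cplx.ofReal h₁) f +
        Complex.I • positionExp (Cplx.ofReal h₂) f) =
      Complex.exp (inner ℂ g f) * (-inner ℂ z f + inner ℂ g z) := by
    have hP : momentumExp (Cplx.ofReal h₁) f = Complex.I •
        (annihilation (Cplx.ofReal h₁).conj ⟨expVec f, expVec_mem_annihilation _ f⟩ -
          creation (Cplx.ofReal h₁) ⟨expVec f, expVec_mem_creation _ f⟩) := rfl
    have hQ : positionExp (Cplx.ofReal h₂) f =
        annihilation (Cplx.ofReal h₂).conj ⟨expVec f, expVec_mem_annihilation _ f⟩ +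
          creation (Cplx.ofReal h₂) ⟨expVec f, expVec_mem_creation _ f⟩ := rfl
    rw [hP, hQ, Cplx.conj_ofReal, Cplx.conj_ofReal, annihilation_expVec, annihilation_expVec]
    simp only [inner_add_right, inner_sub_right, inner_smul_right, inner_expVec_creation,
      inner_expVec, hzr, inner_add_left, inner_smul_left, Complex.conj_I]
    linear_combination (inner ℂ (Cplx.ofReal h₁) f - inner ℂ g (Cplx.ofReal h₁)) *
      Complex.exp (inner ℂ g f) * Complex.I_sq
  rw [h2]
  simp only [h1]
  have h3 : HasDerivAt (fun t : ℂ => Complex.exp (-(t * inner ℂ z f) - t ^ 2 * ((‖z‖ : ℂ) ^ 2 / 2) +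
        (inner ℂ g f + t * inner ℂ g z)))
      (Complex.exp (inner ℂ g f) * (-inner ℂ z f + inner ℂ g z)) ((0 : ℝ) : ℂ) := by
    have h4 := (((((hasDerivAt_id (0 : ℂ)).mul_const (inner ℂ z f)).neg).sub
      (((hasDerivAt_id (0 : ℂ)).pow 2).mul_const ((‖z‖ : ℂ) ^ 2 / 2))).add
        (((hasDerivAt_id (0 : ℂ)).mul_const (inner ℂ g z)).const_add (inner ℂ g f))).cexp
    simpa using h4
  exact h3.comp_ofReal

/-- `fieldExp k f` is the vector `(Q(k₁) - P(k₂)) 𝓔(f)`. -/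
def fieldExp (k : Cplx E × Cplx E) (f : Cplx E) : Fock (Cplx E) :=
  positionExp k.1 f - momentumExp k.2 f

/-- `IsFrechetDeriv k B M` says that the bounded operator `B` belongs to `Dom D_k` and that
`D_k B = M`: the commutator `(i/2) [Q(k₁) - P(k₂), B]`, read as a form on the exponential vectors
(where the adjoint of `Q(k₁) - P(k₂)` is `Q(k̄₁) - P(k̄₂)`), is given by the bounded operator `M`. -/
def IsFrechetDeriv (k : Cplx E × Cplx E) (B M : BddOp E) : Prop :=
  ∀ f g : Cplx E, inner ℂ (expVec f) (M (expVec g)) =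
    Complex.I / 2 * (inner ℂ (fieldExp (k.1.conj, k.2.conj) f) (B (expVec g)) -
      inner ℂ (expVec f) (B (fieldExp k g)))

/-- `IsIterFrechetDeriv k n B M` says that `B` belongs to `Dom (D_k)ⁿ` and that `(D_k)ⁿ B = M`. -/
def IsIterFrechetDeriv (k : Cplx E × Cplx E) :
    ℕ → BddOp E → BddOp E → Prop
  | 0, B, M => M = B
  | n + 1, B, M => ∃ N, IsIterFrechetDeriv k n B N ∧ IsFrechetDeriv k N M

end Operators

/-! ### Trace and density matrices -/

section Trace

variable {H : Type u} [NormedAddCommGroup H] [InnerProductSpace ℂ H] [CompleteSpace H]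

variable (H) in
/-- The index set of a fixed orthonormal basis of `H`. -/
def basisIndex : Set H := (exists_hilbertBasis ℂ H).choose

variable (H) in
/-- A fixed orthonormal basis of `H`. -/
def hilbertBasis : HilbertBasis (basisIndex H) ℂ H := (exists_hilbertBasis ℂ H).choose_spec.choose

/-- The value `tr |T| ∈ [0, ∞]`, where `|T| = √(T* T)`. It does not depend on the basis. -/
def traceAbs (T : H →L[ℂ] H) : ℝ≥0∞ :=
  ∑' i, ENNReal.ofReal (inner ℂ (hilbertBasis H i) (CFC.abs T (hilbertBasis H i))).re

/-- The trace `∑ᵢ ⟨eᵢ, T eᵢ⟩`; for `tr |T| < ∞` the sum converges absolutely and does not depend on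
the basis. -/
def trace (T : H →L[ℂ] H) : ℂ := ∑' i, inner ℂ (hilbertBasis H i) (T (hilbertBasis H i))

/-- Density matrices: positive trace class operators of trace one. -/
def IsDensityMatrix (ρ : H →L[ℂ] H) : Prop := ρ.IsPositive ∧ traceAbs ρ < ⊤ ∧ trace ρ = 1

end Trace

/-! ### Weyl calculus and Wigner densities -/

section Weyl

/-- The inverse Fourier transform
`(𝓕⁻¹ φ)(u, v) = (1 / 2π) ∫ φ(x, y) exp(-i (u x + v y)) dx dy`. -/
def invFourier (φ : ℝ × ℝ → ℂ) (q : ℝ × ℝ) : ℂ :=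
  (1 / (2 * Real.pi) : ℝ) *
    ∫ p : ℝ × ℝ, φ p * Complex.exp (-(Complex.I * ((q.1 * p.1 + q.2 * p.2 : ℝ) : ℂ)))

variable {E : Type u} [NormedAddCommGroup E] [InnerProductSpace ℝ E]

/-- `IsWeylQuantization h φ M` says that `M = O_h(φ)`, that is,
`⟨𝓔(f), M 𝓔(g)⟩ = (1 / 2π) ∫ ⟨𝓔(f), U(u h₁, v h₂) 𝓔(g)⟩ (𝓕⁻¹ φ)(u, v) du dv` for all `f`, `g`. -/
def IsWeylQuantization (h : E × E) (φ : ℝ × ℝ → ℂ) (M : BddOp E) : Prop :=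
  ∀ f g : Cplx E, inner ℂ (expVec f) (M (expVec g)) =
    (1 / (2 * Real.pi) : ℝ) * ∫ q : ℝ × ℝ,
      inner ℂ (expVec f) (weyl (q.1 • h.1) (q.2 • h.2) (expVec g)) * invFourier φ q

/-- `w` is the (real-valued) density, with respect to Lebesgue measure on the plane, of the Wigner
distribution of `(P(h₁), Q(h₂))` in the state `Φ`: `∫ φ w = Φ(O_h(φ))` for every Schwartz
function `φ`. -/
def IsWignerDensity (h : E × E) (Φ : BddOp E → ℂ)
    (w : ℝ × ℝ → ℝ) : Prop :=
  ∀ φ : 𝓢(ℝ × ℝ, ℂ), ∃ M, IsWeylQuantization h φ M ∧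
    Integrable (fun p => φ p * (w p : ℂ)) ∧ ∫ p : ℝ × ℝ, φ p * (w p : ℂ) = Φ M

end Weyl

/-! ### Sobolev spaces on the plane -/

section Sobolev

/-- The partial derivative `∂^(a+b) φ / ∂x^a ∂y^b`. -/
def partialDeriv (a b : ℕ) (φ : ℝ × ℝ → ℝ) : ℝ × ℝ → ℝ :=
  (fun (ψ : ℝ × ℝ → ℝ) (z : ℝ × ℝ) => fderiv ℝ ψ z (1, 0))^[a]
    ((fun (ψ : ℝ × ℝ → ℝ) (z : ℝ × ℝ) => fderiv ℝ ψ z (0, 1))^[b] φ)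

/-- `g` is the weak derivative `∂^(a+b) w / ∂x^a ∂y^b`. -/
def IsWeakDeriv (a b : ℕ) (w g : ℝ × ℝ → ℝ) : Prop :=
  ∀ φ : ℝ × ℝ → ℝ, ContDiff ℝ ((⊤ : ℕ∞) : WithTop ℕ∞) φ → HasCompactSupport φ →
    ∫ z, w z * partialDeriv a b φ z = (-1) ^ (a + b) * ∫ z, g z * φ z

/-- The Sobolev space `H^{p,κ}(ℝ²)`: functions in `L^p` whose weak derivatives up to order `κ` are
in `L^p`. -/
def MemSobolev (w : ℝ × ℝ → ℝ) (p : ℝ≥0∞) (κ : ℕ) : Prop :=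
  MemLp w p ∧ ∀ a b : ℕ, a + b ≤ κ → ∃ g : ℝ × ℝ → ℝ, MemLp g p ∧ IsWeakDeriv a b w g

end Sobolev

end WignerMalliavin
end

/-!
The state enters only through its characteristic function `χ(q) = tr (ρ U(q))` on the plane, where
`U(q) = U(u h₁, v h₂)`. A Wigner density is a real-valued weak Fourier transform of `χ`
(`isWignerDensity_iff`), and multiplying `χ` by `u^a v^b` differentiates it
(`isWeakDeriv_of_isFourierDensity`). So it is enough that each weighted function `u^a v^b χ` with
`a + b ≤ κ` has a Fourier transform in `L² ∩ L^∞`.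

*Removing the weights.* If `D_k B = M` with both operators trace class, then
`tr (M U(q)) = -i s(q) tr (B U(q))`, where `s(q) = u ⟨h₁, k₁⟩ + v ⟨h₂, k₂⟩`
(`charFn_of_isFrechetDeriv`). Formally this is cyclicity of the trace and the commutation relation
of `U(q)` with the field operators. These are unbounded, so they are first multiplied by the
second quantization `Γ(r)`, `r < 1`, which makes them bounded; the commutator of `Γ(r)²` with a
field operator tends to zero in norm as `r → 1` (`exists_regularized_field`). The determinant
condition writes `u` and `v` as linear combinations of the symbols of `D_k` and `D_ℓ`, so every
`u^a v^b χ` is a linear combination of characteristic functions of the trace class operators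
`D_k^m D_ℓ^n ρ` (`hasBoundedDensity_coord_pow`).

*Characteristic functions of trace class operators.* A trace class operator is an absolutely
convergent sum of operators of rank one (`exists_isNuclear`), which reduces the bounds to
`q ↦ ⟨ξ, U(q) ψ⟩`. Let `c = ⟨h₁, h₂⟩ ≠ 0`, and let `q ↦ η(q)` be a family of vectors with
`⟨η(q), η(q')⟩ = exp(i c ω(q, q')) ⟨η(0), η(q' - q)⟩`, where `ω` is the determinant on the plane.
The norm of its Gaussian average `∫ exp(-ε|q|²) η(q) dq` is bounded uniformly in `ε`, because the
oscillation of the phase makes up for the slow decay of the Gaussian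
(`norm_integral_gauss_smul_le`). For `η(q) = exp(-i q·p) U(q) ψ` this bounds the Fourier transform
of `⟨ξ, U(q) ψ⟩` at every point `p`, that is, in `L^∞`; for `η(q) = U(q) ψ ⊗ U(-q) ξ'`, with `2c`
in place of `c`, it bounds the integral of `⟨ξ, U(q) ψ⟩` against the conjugate of `⟨ξ', U(q) ψ'⟩`.
The latter shows that `χ` is square integrable (`memLp_charFn`), and Plancherel's theorem puts its
Fourier transform into `L²`.
-/

namespace WignerMalliavin

/-! ### Nuclear operators -/

section Nuclear

universe v

variable {H : Type v} [NormedAddCommGroup H] [InnerProductSpace ℂ H] [CompleteSpace H]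

/-- `A = ∑ᵢ |ψᵢ⟩⟨ξᵢ|` with `∑ᵢ ‖ξᵢ‖ ‖ψᵢ‖ < ∞`, the series converging weakly. -/
structure IsNuclear {ι : Type*} (A : H →L[ℂ] H) (ξ ψ : ι → H) : Prop where
  summable : Summable fun i => ‖ξ i‖ * ‖ψ i‖
  hasSum : ∀ x y, HasSum (fun i => inner ℂ (ξ i) x * inner ℂ y (ψ i)) (inner ℂ y (A x))

theorem sum_norm_inner_mul_inner_le {J : Type*} (e : HilbertBasis J ℂ H) (x y : H) (s : Finset J) :
    ∑ j ∈ s, ‖inner ℂ x (e j) * inner ℂ (e j) y‖ ≤ ‖x‖ * ‖y‖ := by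
  have hb : ∀ z : H, √(∑ j ∈ s, ‖inner ℂ (e j) z‖ ^ 2) ≤ ‖z‖ := fun z =>
    (Real.sqrt_le_sqrt (e.orthonormal.sum_inner_products_le z)).trans
      (Real.sqrt_sq (norm_nonneg z)).le
  calc ∑ j ∈ s, ‖inner ℂ x (e j) * inner ℂ (e j) y‖
      = ∑ j ∈ s, ‖inner ℂ (e j) x‖ * ‖inner ℂ (e j) y‖ := by
        refine Finset.sum_congr rfl fun j _ => ?_
        rw [norm_mul, norm_inner_symm]
    _ ≤ √(∑ j ∈ s, ‖inner ℂ (e j) x‖ ^ 2) * √(∑ j ∈ s, ‖inner ℂ (e j) y‖ ^ 2) :=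
        Real.sum_mul_le_sqrt_mul_sqrt _ _ _
    _ ≤ ‖x‖ * ‖y‖ := mul_le_mul (hb x) (hb y) (Real.sqrt_nonneg _) (norm_nonneg _)

namespace IsNuclear

variable {ι : Type*} {A : H →L[ℂ] H} {ξ ψ : ι → H}

theorem norm_inner_le (_hA : IsNuclear A ξ ψ) (B : H →L[ℂ] H) (i : ι) :
    ‖inner ℂ (ξ i) (B (ψ i))‖ ≤ ‖ξ i‖ * ‖ψ i‖ * ‖B‖ := by
  refine (norm_inner_le_norm _ _).trans ?_
  rw [mul_assoc, mul_comm ‖ψ i‖]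
  exact mul_le_mul_of_nonneg_left (B.le_opNorm _) (norm_nonneg _)

theorem summable_inner (hA : IsNuclear A ξ ψ) (B : H →L[ℂ] H) :
    Summable fun i => inner ℂ (ξ i) (B (ψ i)) :=
  Summable.of_norm_bounded (hA.summable.mul_right ‖B‖) (hA.norm_inner_le B)

/-- The trace of `A B`, computed in any orthonormal basis, is `∑ᵢ ⟨ξᵢ, B ψᵢ⟩`: the double series over
`i` and the basis converges absolutely, so the order of summation is immaterial. -/
theorem hasSum_inner_basis (hA : IsNuclear A ξ ψ) {J : Type*} (e : HilbertBasis J ℂ H)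
    (B : H →L[ℂ] H) :
    HasSum (fun j => inner ℂ (e j) ((A * B) (e j))) (∑' i, inner ℂ (ξ i) (B (ψ i))) := by
  let F : ι × J → ℂ := fun z =>
    inner ℂ (ContinuousLinearMap.adjoint B (ξ z.1)) (e z.2) * inner ℂ (e z.2) (ψ z.1)
  have hF : Summable F := by
    refine Summable.of_norm ?_
    rw [summable_prod_of_nonneg fun _ => norm_nonneg _]
    have h0 : ∀ i (s : Finset J), ∑ j ∈ s, ‖F (i, j)‖ ≤
        ‖ContinuousLinearMap.adjoint B (ξ i)‖ * ‖ψ i‖ := fun i s =>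
      sum_norm_inner_mul_inner_le e (ContinuousLinearMap.adjoint B (ξ i)) (ψ i) s
    have h1 : ∀ i, Summable fun j => ‖F (i, j)‖ := fun i =>
      summable_of_sum_le (fun _ => norm_nonneg _) (h0 i)
    refine ⟨h1, Summable.of_nonneg_of_le (fun i => tsum_nonneg fun _ => norm_nonneg _) (fun i => ?_)
      (hA.summable.mul_left ‖ContinuousLinearMap.adjoint B‖)⟩
    refine ((h1 i).tsum_le_of_sum_le (h0 i)).trans ?_
    rw [← mul_assoc]
    exact mul_le_mul_of_nonneg_right (ContinuousLinearMap.le_opNorm _ _) (norm_nonneg _)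
  have h2 : HasSum (fun i => inner ℂ (ξ i) (B (ψ i))) (∑' z, F z) := by
    refine hF.hasSum.prod_fiberwise fun i => ?_
    have := e.hasSum_inner_mul_inner (ContinuousLinearMap.adjoint B (ξ i)) (ψ i)
    rwa [ContinuousLinearMap.adjoint_inner_left] at this
  rw [h2.tsum_eq]
  have h3 : HasSum (fun z : J × ι => F z.swap) (∑' z, F z) :=
    (Equiv.prodComm J ι).hasSum_iff.2 hF.hasSum
  refine h3.prod_fiberwise fun j => ?_
  have := hA.hasSum (B (e j)) (e j)
  simpa only [F, Prod.swap, ContinuousLinearMap.adjoint_inner_left, mul_apply_eq_comp] using this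

theorem hasSum_trace (hA : IsNuclear A ξ ψ) (B : H →L[ℂ] H) :
    HasSum (fun j => inner ℂ (hilbertBasis H j) ((A * B) (hilbertBasis H j))) (trace (A * B)) :=
  (hA.hasSum_inner_basis _ B).summable.hasSum

theorem hasSum_inner (hA : IsNuclear A ξ ψ) (B : H →L[ℂ] H) :
    HasSum (fun i => inner ℂ (ξ i) (B (ψ i))) (trace (A * B)) := by
  rw [trace, (hA.hasSum_inner_basis (hilbertBasis H) B).tsum_eq]
  exact (hA.summable_inner B).hasSum

theorem norm_trace_le (hA : IsNuclear A ξ ψ) (B : H →L[ℂ] H) :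
    ‖trace (A * B)‖ ≤ (∑' i, ‖ξ i‖ * ‖ψ i‖) * ‖B‖ := by
  rw [← (hA.hasSum_inner B).tsum_eq, ← tsum_mul_right]
  exact tsum_of_norm_bounded (hA.summable.mul_right _).hasSum (hA.norm_inner_le B)

theorem mul_left (hA : IsNuclear A ξ ψ) (L : H →L[ℂ] H) :
    IsNuclear (L * A) ξ fun i => L (ψ i) where
  summable := by
    refine Summable.of_nonneg_of_le (fun _ => by positivity) (fun i => ?_)
      (hA.summable.mul_right ‖L‖)
    rw [mul_assoc, mul_comm ‖ψ i‖]
    exact mul_le_mul_of_nonneg_left (L.le_opNorm _) (norm_nonneg _)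
  hasSum x y := by
    have := hA.hasSum x (ContinuousLinearMap.adjoint L y)
    simpa only [ContinuousLinearMap.adjoint_inner_left, mul_apply_eq_comp] using this

/-- Cyclicity of the trace when only `A` is nuclear, with `B` and `L` merely bounded. -/
theorem trace_mul_cycle (hA : IsNuclear A ξ ψ) (L B : H →L[ℂ] H) :
    trace (L * A * B) = trace (A * (B * L)) := by
  rw [← ((hA.mul_left L).hasSum_inner B).tsum_eq, ← (hA.hasSum_inner (B * L)).tsum_eq]
  rfl

theorem adjoint (hA : IsNuclear A ξ ψ) : IsNuclear (ContinuousLinearMap.adjoint A) ψ ξ where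
  summable := by simpa only [mul_comm] using hA.summable
  hasSum x y := by
    have h := (hA.hasSum y x).star
    rw [ContinuousLinearMap.adjoint_inner_right, ← inner_conj_symm]
    refine h.congr_fun fun i => ?_
    simp only [Complex.star_def, map_mul, inner_conj_symm]
    exact mul_comm _ _

/-- `B ↦ tr (A B)` is continuous along uniformly bounded, strongly convergent families, although the
convergence need not be in norm. -/
theorem tendsto_trace {α : Type*} {l : Filter α} (hA : IsNuclear A ξ ψ) {T : α → H →L[ℂ] H}
    {C : ℝ} {B : H →L[ℂ] H} (hC : ∀ᶠ r in l, ‖T r‖ ≤ C)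
    (hT : ∀ x, Filter.Tendsto (fun r => T r x) l (nhds (B x))) :
    Filter.Tendsto (fun r => trace (A * T r)) l (nhds (trace (A * B))) := by
  simp only [← (hA.hasSum_inner _).tsum_eq]
  refine tendsto_tsum_of_dominated_convergence (hA.summable.mul_right C)
    (fun i => tendsto_const_nhds.inner (hT (ψ i))) ?_
  filter_upwards [hC] with r hr i
  exact (hA.norm_inner_le _ i).trans (mul_le_mul_of_nonneg_left hr (by positivity))

end IsNuclear

/-- Polar decomposition: a bounded operator is a contraction times its absolute value. -/
theorem exists_contraction_mul_abs (T : H →L[ℂ] H) :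
    ∃ W : H →L[ℂ] H, (∀ x, ‖W x‖ ≤ ‖x‖) ∧ ∀ x, T x = W (CFC.abs T x) := by
  set P := CFC.abs T with hP
  have hsa : IsSelfAdjoint P := (CFC.abs_nonneg T).isSelfAdjoint
  have hsym : ∀ x y, inner ℂ (P x) y = inner ℂ x (P y) := fun x y => by
    rw [← ContinuousLinearMap.adjoint_inner_right, hsa.adjoint_eq]
  have hPP : P * P = ContinuousLinearMap.adjoint T * T := CFC.abs_mul_abs T
  have hnorm : ∀ x, ‖T x‖ = ‖P x‖ := by
    intro x
    have h : inner ℂ (T x) (T x) = inner ℂ (P x) (P x) := by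
      rw [hsym, ← mul_apply_eq_comp, hPP, mul_apply_eq_comp,
        ContinuousLinearMap.adjoint_inner_right]
    rw [@norm_eq_sqrt_re_inner ℂ, @norm_eq_sqrt_re_inner ℂ, h]
  -- on `range |T| ⊕ ker |T|`, a dense subspace, the contraction is `|T| x + z ↦ T x`
  let K := LinearMap.ker (P : H →ₗ[ℂ] H)
  let e : H × K →ₗ[ℂ] H := (P : H →ₗ[ℂ] H).coprod K.subtype
  let f : H × K →ₗ[ℂ] H := (T : H →ₗ[ℂ] H).comp (LinearMap.fst ℂ H K)
  have he : ∀ z : H × K, e z = P z.1 + z.2 := fun z => rfl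
  have hf : ∀ z : H × K, f z = T z.1 := fun z => rfl
  have hker : ∀ z : K, P z = 0 := fun z => z.2
  have hle : ∀ z, ‖f z‖ ≤ 1 * ‖e z‖ := by
    intro z
    rw [one_mul, hf, he, hnorm]
    have h0 : inner ℂ (P z.1) (z.2 : H) = 0 := by rw [hsym, hker, inner_zero_right]
    have h1 := norm_add_sq_eq_norm_sq_add_norm_sq_of_inner_eq_zero (P z.1) (z.2 : H) h0
    nlinarith [norm_nonneg (P z.1), norm_nonneg (P z.1 + (z.2 : H)), norm_nonneg (z.2 : H)]
  have hdense : DenseRange e := by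
    have h1 : (LinearMap.range e).topologicalClosure = ⊤ := by
      rw [Submodule.topologicalClosure_eq_top_iff, Submodule.eq_bot_iff]
      intro y hy
      have hy' : ∀ z, inner ℂ (e z) y = 0 := fun z =>
        (Submodule.mem_orthogonal _ _).1 hy _ (LinearMap.mem_range_self e z)
      have h2 : P y = 0 := by
        refine ext_inner_left ℂ fun x => ?_
        have := hy' (x, 0)
        rw [he] at this
        simpa [← hsym] using this
      have h3 := hy' (0, ⟨y, h2⟩)
      rw [he] at h3
      simpa using h3
    exact Submodule.dense_iff_topologicalClosure_eq_top.2 h1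
  refine ⟨f.extendOfNorm e, fun x => ?_, fun x => ?_⟩
  · simpa using LinearMap.norm_extendOfNorm_apply_le hdense 1 hle x
  · have := LinearMap.extendOfNorm_eq hdense ⟨1, hle⟩ (x, 0)
    rw [he, hf] at this
    simpa using this.symm

/-- An operator with `tr |T| < ∞` is nuclear: with `|T| = S²` and `T = W |T|`, the vectors
`ξᵢ = S eᵢ` and `ψᵢ = W S eᵢ` do, and `∑ᵢ ‖S eᵢ‖² = tr |T|`. -/
theorem exists_isNuclear {T : H →L[ℂ] H} (hT : traceAbs T < ⊤) :
    ∃ (ι : Type v) (_ : Countable ι) (ξ ψ : ι → H), IsNuclear T ξ ψ := by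
  obtain ⟨W, hW, hTW⟩ := exists_contraction_mul_abs T
  set S : H →L[ℂ] H := CFC.sqrt (CFC.abs T) with hS
  have hSS : S * S = CFC.abs T := CFC.sqrt_mul_sqrt_self _ (CFC.abs_nonneg T)
  have hsa : IsSelfAdjoint S := (CFC.sqrt_nonneg _).isSelfAdjoint
  have hsym : ∀ x y, inner ℂ (S x) y = inner ℂ x (S y) := fun x y => by
    rw [← ContinuousLinearMap.adjoint_inner_right, hsa.adjoint_eq]
  set e := hilbertBasis H with he
  have hsum : Summable fun i => ‖S (e i)‖ ^ 2 := by
    have h1 : ∀ i, (inner ℂ (e i) (CFC.abs T (e i))).re = ‖S (e i)‖ ^ 2 := fun i => by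
      rw [← hSS, mul_apply_eq_comp, ← hsym]
      exact inner_self_eq_norm_sq (𝕜 := ℂ) _
    rw [traceAbs] at hT
    simp only [← he, h1] at hT
    have h2 := ENNReal.summable_toReal hT.ne
    refine h2.congr fun i => ?_
    rw [ENNReal.toReal_ofReal (by positivity)]
  have hN : IsNuclear T (fun i => S (e i)) fun i => W (S (e i)) := by
    refine ⟨Summable.of_nonneg_of_le (fun _ => by positivity) (fun i => ?_) hsum, fun x y => ?_⟩
    · rw [sq]; exact mul_le_mul_of_nonneg_left (hW _) (norm_nonneg _)
    · have h := e.hasSum_inner_mul_inner (ContinuousLinearMap.adjoint (W * S) y) (S x)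
      rw [ContinuousLinearMap.adjoint_inner_left, mul_apply_eq_comp,
        ← mul_apply_eq_comp S S, hSS, ← hTW] at h
      refine h.congr_fun fun i => ?_
      rw [ContinuousLinearMap.adjoint_inner_left, hsym, mul_comm]
      rfl
  -- only countably many terms are nonzero
  let s := Function.support fun i => ‖S (e i)‖ * ‖W (S (e i))‖
  refine ⟨s, hN.summable.countable_support.to_subtype, fun i => S (e i), fun i => W (S (e i)),
    hN.summable.subtype s, fun x y => ?_⟩
  refine (hasSum_subtype_iff_of_support_subset fun i hi => ?_).2 (hN.hasSum x y)
  intro h0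
  refine hi ?_
  rcases mul_eq_zero.1 h0 with h | h
  · simp [norm_eq_zero.1 h]
  · simp [norm_eq_zero.1 h]

end Nuclear

/-! ### Oscillating Gaussian integrals of vectors -/

/-- The Gaussian `exp (-ε (u² + v²))` on the plane. -/
noncomputable def gauss (ε : ℝ) (q : ℝ × ℝ) : ℝ := Real.exp (-ε * (q.1 ^ 2 + q.2 ^ 2))

theorem gauss_pos (ε : ℝ) (q : ℝ × ℝ) : 0 < gauss ε q := Real.exp_pos _

theorem gauss_le_one {ε : ℝ} (hε : 0 ≤ ε) (q : ℝ × ℝ) : gauss ε q ≤ 1 := by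
  rw [gauss, Real.exp_le_one_iff]
  have : 0 ≤ ε * (q.1 ^ 2 + q.2 ^ 2) := by positivity
  linarith

theorem continuous_gauss (ε : ℝ) : Continuous (gauss ε) := by unfold gauss; fun_prop

theorem gauss_eq_mul (ε : ℝ) (q : ℝ × ℝ) :
    gauss ε q = Real.exp (-ε * q.1 ^ 2) * Real.exp (-ε * q.2 ^ 2) := by
  rw [gauss, ← Real.exp_add]; congr 1; ring

theorem integrable_gauss {ε : ℝ} (hε : 0 < ε) : Integrable (gauss ε) :=
  ((integrable_exp_neg_mul_sq hε).mul_prod (integrable_exp_neg_mul_sq hε)).congr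
    (Filter.Eventually.of_forall fun q => (gauss_eq_mul ε q).symm)

theorem integral_gauss (ε : ℝ) : ∫ q, gauss ε q = √(Real.pi / ε) * √(Real.pi / ε) := by
  simp_rw [gauss_eq_mul]
  rw [Measure.volume_eq_prod, integral_prod_mul (fun u : ℝ => Real.exp (-ε * u ^ 2))
    (fun u : ℝ => Real.exp (-ε * u ^ 2)), integral_gaussian]

/-- A bounded continuous function times a Gaussian is integrable. -/
theorem integrable_gauss_smul {F : Type*} [NormedAddCommGroup F] [NormedSpace ℂ F]
    {η : ℝ × ℝ → F} (hη : Continuous η) {C : ℝ} (hC : ∀ q, ‖η q‖ ≤ C) {ε : ℝ} (hε : 0 < ε) :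
    Integrable fun q => (gauss ε q : ℂ) • η q := by
  refine Integrable.mono' ((integrable_gauss hε).mul_const C)
    ((Complex.continuous_ofReal.comp (continuous_gauss ε)).smul hη).aestronglyMeasurable
    (Filter.Eventually.of_forall fun q => ?_)
  rw [norm_smul, Complex.norm_real, Real.norm_eq_abs, abs_of_pos (gauss_pos _ _)]
  exact mul_le_mul_of_nonneg_left (hC q) (gauss_pos _ _).le

/-- The Fourier transform of a product of two shifted Gaussians of width `ε^(-1/2)` decays like a
Gaussian of width `ε^(1/2)` in the frequency, uniformly in the shift. -/
theorem norm_integral_gauss_shift_le {ε : ℝ} (hε : 0 < ε) (s t : ℝ) :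
    ‖∫ u : ℝ, Complex.exp (-ε * (u ^ 2 + (u + s) ^ 2) + Complex.I * (t * u))‖ ≤
      √(Real.pi / (2 * ε)) * Real.exp (-(8 * ε)⁻¹ * t ^ 2) := by
  have h1 : ∀ u : ℝ, Complex.exp (-ε * (u ^ 2 + (u + s) ^ 2) + Complex.I * (t * u)) =
      Complex.exp ((-(2 * ε : ℝ) : ℂ) * u ^ 2 + (-2 * ε * s + Complex.I * t) * u + -ε * s ^ 2) := by
    intro u; congr 1; push_cast; ring
  simp_rw [h1]
  rw [integral_cexp_quadratic (by simp [hε]), neg_neg, norm_mul, Complex.norm_exp]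
  have hε' : (ε : ℂ) ≠ 0 := by exact_mod_cast hε.ne'
  have h2 : (-ε * s ^ 2 - (-2 * ε * s + Complex.I * t) ^ 2 / (4 * (-(2 * ε : ℝ) : ℂ)) : ℂ) =
      ((-(ε * s ^ 2) / 2 - (8 * ε)⁻¹ * t ^ 2 : ℝ) : ℂ) + ((-(s * t) / 2 : ℝ) : ℂ) * Complex.I := by
    push_cast
    field_simp
    ring_nf
    rw [Complex.I_sq]
    ring
  rw [h2]
  have h3 : ‖((Real.pi : ℂ) / ((2 * ε : ℝ) : ℂ)) ^ (1 / 2 : ℂ)‖ = √(Real.pi / (2 * ε)) := by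
    rw [← Complex.ofReal_div, show (1 / 2 : ℂ) = ((1 / 2 : ℝ) : ℂ) by push_cast; rfl,
      ← Complex.ofReal_cpow (by positivity), Complex.norm_real, Real.norm_eq_abs,
      abs_of_nonneg (by positivity), Real.sqrt_eq_rpow]
  rw [h3]
  refine mul_le_mul_of_nonneg_left (Real.exp_le_exp.2 ?_) (Real.sqrt_nonneg _)
  simp only [Complex.add_re, Complex.ofReal_re, Complex.mul_re, Complex.I_re, mul_zero,
    Complex.ofReal_im, Complex.I_im, sub_self, add_zero, zero_mul]
  have : 0 ≤ ε * s ^ 2 := by positivity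
  linarith

/-- Gaussian averages of a family of vectors whose Gram matrix is a twisted translation-invariant
kernel are bounded uniformly in the width of the Gaussian: after a change of variables the square
of the norm of the average is an integral of the bounded function `p ↦ ⟪η 0, η p⟫` against an
oscillating Gaussian integral, and the latter is dominated by a Gaussian of fixed mass. -/
theorem norm_integral_gauss_smul_le {F : Type*} [NormedAddCommGroup F] [InnerProductSpace ℂ F]
    [CompleteSpace F] {c : ℝ} (hc : c ≠ 0) {η : ℝ × ℝ → F} (hη : Continuous η)
    (hG : ∀ q q', inner ℂ (η q) (η q') =
      Complex.exp (Complex.I * ((c * (q.1 * q'.2 - q.2 * q'.1) : ℝ) : ℂ)) *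
        inner ℂ (η 0) (η (q' - q)))
    {ε : ℝ} (hε : 0 < ε) :
    ‖∫ q, (gauss ε q : ℂ) • η q‖ ≤ 2 * Real.pi / |c| * ‖η 0‖ := by
  have hnorm : ∀ q, ‖η q‖ = ‖η 0‖ := by
    intro q
    have h := hG q q
    rw [sub_self, show c * (q.1 * q.2 - q.2 * q.1) = 0 by ring] at h
    simp only [Complex.ofReal_zero, mul_zero, Complex.exp_zero, one_mul] at h
    rw [@norm_eq_sqrt_re_inner ℂ, @norm_eq_sqrt_re_inner ℂ, h]
  have hint := integrable_gauss_smul hη (fun q => (hnorm q).le) hε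
  -- the kernel after the substitution `q' = q + p`
  let k : ℝ × ℝ → ℝ × ℝ → ℂ := fun q p =>
    (gauss ε q : ℂ) * gauss ε (q + p) * Complex.exp (Complex.I * ((c * (q.1 * p.2 - q.2 * p.1) : ℝ) : ℂ))
  have h1 : inner ℂ (∫ q, (gauss ε q : ℂ) • η q) (∫ q, (gauss ε q : ℂ) • η q) =
      ∫ q, ∫ p, k q p * inner ℂ (η 0) (η p) := by
    rw [← inner_conj_symm, ← integral_inner hint, ← integral_conj]
    congr 1; ext q
    rw [inner_conj_symm, inner_smul_left, ← integral_inner hint, ← integral_add_left_eq_self _ q,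
      ← integral_const_mul]
    congr 1; ext p
    rw [inner_smul_right, hG q (q + p), add_sub_cancel_left, Complex.conj_ofReal]
    simp only [k, Prod.fst_add, Prod.snd_add]
    rw [show q.1 * (q.2 + p.2) - q.2 * (q.1 + p.1) = q.1 * p.2 - q.2 * p.1 by ring]
    ring
  have hcont : Continuous (Function.uncurry fun q p => k q p * inner ℂ (η 0) (η p)) := by
    have := continuous_gauss ε
    simp only [k, Function.uncurry_def]
    fun_prop
  have hexp : ∀ r : ℝ, ‖Complex.exp (Complex.I * (r : ℂ))‖ = 1 := fun r => by
    rw [mul_comm]; exact Complex.norm_exp_ofReal_mul_I r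
  have hk : Integrable (Function.uncurry fun q p => k q p * inner ℂ (η 0) (η p))
      ((volume : Measure (ℝ × ℝ)).prod volume) := by
    refine Integrable.mono' (((integrable_gauss (ε := ε / 4) (by positivity)).mul_prod
      (integrable_gauss (ε := ε / 4) (by positivity))).mul_const (‖η 0‖ * ‖η 0‖))
      hcont.aestronglyMeasurable (Filter.Eventually.of_forall fun z => ?_)
    obtain ⟨q, p⟩ := z
    simp only [Function.uncurry, k]
    rw [norm_mul, norm_mul, norm_mul, hexp, mul_one, Complex.norm_real, Complex.norm_real,
      Real.norm_eq_abs, Real.norm_eq_abs, abs_of_pos (gauss_pos _ _), abs_of_pos (gauss_pos _ _)]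
    have h2 : ‖inner ℂ (η 0) (η p)‖ ≤ ‖η 0‖ * ‖η 0‖ := by
      refine (norm_inner_le_norm _ _).trans ?_
      rw [hnorm p]
    -- the form `|q|² + |q + p|²` is positive definite in `(q, p)`, with lower bound `(|q|² + |p|²) / 4`
    have h3 : gauss ε q * gauss ε (q + p) ≤ gauss (ε / 4) q * gauss (ε / 4) p := by
      simp only [gauss, ← Real.exp_add, Prod.fst_add, Prod.snd_add]
      refine Real.exp_le_exp.2 ?_
      have h4 : q.1 ^ 2 + q.2 ^ 2 + (p.1 ^ 2 + p.2 ^ 2) ≤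
          4 * (q.1 ^ 2 + q.2 ^ 2 + ((q.1 + p.1) ^ 2 + (q.2 + p.2) ^ 2)) := by
        nlinarith [sq_nonneg (2 * q.1 + p.1), sq_nonneg (2 * q.2 + p.2), sq_nonneg q.1,
          sq_nonneg q.2, sq_nonneg (q.1 + p.1), sq_nonneg (q.2 + p.2)]
      nlinarith [mul_le_mul_of_nonneg_left h4 hε.le]
    exact mul_le_mul h3 h2 (norm_nonneg _) (mul_nonneg (gauss_pos _ _).le (gauss_pos _ _).le)
  -- the `q`-integral factors; the phase has frequencies `c p₂` and `-c p₁` in the two variables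
  have hinner : ∀ p : ℝ × ℝ, ‖∫ q, k q p‖ ≤ Real.pi / (2 * ε) * gauss (c ^ 2 * (8 * ε)⁻¹) p := by
    intro p
    have h5 : ∀ q : ℝ × ℝ, k q p =
        Complex.exp (-ε * (q.1 ^ 2 + (q.1 + p.1) ^ 2) + Complex.I * ((c * p.2 : ℝ) * q.1)) *
        Complex.exp (-ε * (q.2 ^ 2 + (q.2 + p.2) ^ 2) + Complex.I * ((-(c * p.1) : ℝ) * q.2)) := by
      intro q
      simp only [k, gauss, Complex.ofReal_exp, ← Complex.exp_add]
      congr 1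
      simp only [Prod.fst_add, Prod.snd_add]
      push_cast
      ring
    simp_rw [h5]
    rw [Measure.volume_eq_prod, integral_prod_mul
      (fun u : ℝ => Complex.exp (-ε * (u ^ 2 + (u + p.1) ^ 2) + Complex.I * ((c * p.2 : ℝ) * u)))
      (fun v : ℝ => Complex.exp (-ε * (v ^ 2 + (v + p.2) ^ 2) + Complex.I * ((-(c * p.1) : ℝ) * v))),
      norm_mul]
    refine (mul_le_mul (norm_integral_gauss_shift_le hε _ _) (norm_integral_gauss_shift_le hε _ _)
      (norm_nonneg _) (by positivity)).trans (le_of_eq ?_)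
    rw [mul_mul_mul_comm, Real.mul_self_sqrt (by positivity), ← Real.exp_add, gauss]
    congr 2
    ring
  have hle : ‖∫ q, (gauss ε q : ℂ) • η q‖ ^ 2 ≤ (2 * Real.pi / |c| * ‖η 0‖) ^ 2 := by
    rw [← @inner_self_eq_norm_sq ℂ, h1, integral_integral_swap hk]
    refine (RCLike.re_le_norm _).trans ((norm_integral_le_integral_norm _).trans ?_)
    have hc2 : 0 < c ^ 2 * (8 * ε)⁻¹ := by positivity
    calc ∫ p, ‖∫ q, k q p * inner ℂ (η 0) (η p)‖
        ≤ ∫ p, Real.pi / (2 * ε) * gauss (c ^ 2 * (8 * ε)⁻¹) p * (‖η 0‖ * ‖η 0‖) := by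
          refine integral_mono_of_nonneg (Filter.Eventually.of_forall fun _ => norm_nonneg _)
            (((integrable_gauss hc2).const_mul _).mul_const _)
            (Filter.Eventually.of_forall fun p => ?_)
          beta_reduce
          rw [integral_mul_const, norm_mul]
          refine mul_le_mul (hinner p) ?_ (norm_nonneg _)
            (mul_nonneg (by positivity) (gauss_pos _ _).le)
          refine (norm_inner_le_norm _ _).trans ?_
          rw [hnorm p]
      _ = (2 * Real.pi / |c| * ‖η 0‖) ^ 2 := by
          rw [integral_mul_const, integral_const_mul, integral_gauss,
            Real.mul_self_sqrt (by positivity), mul_pow, div_pow, sq_abs]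
          field_simp
          ring
  exact (sq_le_sq₀ (norm_nonneg _) (by positivity)).1 hle

/-! ### Weyl systems -/

section WeylSystem

universe v

variable {H : Type v} [NormedAddCommGroup H] [InnerProductSpace ℂ H]

/-- A strongly continuous unitary representation of the Weyl relations over the plane with
parameter `c`. The relations `U(q)* = U(-q)` and `U(q) U(q') = exp(-i c σ(q, q')) U(q + q')`,
`σ(q, q') = q₁ q'₂ - q₂ q'₁`, are encoded in a single formula for matrix elements. -/
structure IsWeylSystem (c : ℝ) (U : ℝ × ℝ → H →L[ℂ] H) : Prop where
  zero : U 0 = 1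
  inner_apply : ∀ q q' x y, inner ℂ (U q x) (U q' y) =
    Complex.exp (Complex.I * ((c * (q.1 * q'.2 - q.2 * q'.1) : ℝ) : ℂ)) *
      inner ℂ x (U (q' - q) y)
  continuous : ∀ x, Continuous fun q => U q x

namespace IsWeylSystem

variable {c : ℝ} {U : ℝ × ℝ → H →L[ℂ] H}

theorem norm_apply (hU : IsWeylSystem c U) (q : ℝ × ℝ) (x : H) : ‖U q x‖ = ‖x‖ := by
  have h := hU.inner_apply q q x x
  rw [sub_self, hU.zero, show c * (q.1 * q.2 - q.2 * q.1) = 0 by ring] at h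
  simp only [Complex.ofReal_zero, mul_zero, Complex.exp_zero, one_mul,
    one_apply_eq_self] at h
  rw [@norm_eq_sqrt_re_inner ℂ, @norm_eq_sqrt_re_inner ℂ, h]

theorem norm_le_one (hU : IsWeylSystem c U) (q : ℝ × ℝ) : ‖U q‖ ≤ 1 :=
  ContinuousLinearMap.opNorm_le_bound _ zero_le_one fun x => by rw [hU.norm_apply, one_mul]

theorem inner_apply_left (hU : IsWeylSystem c U) (q : ℝ × ℝ) (x y : H) :
    inner ℂ (U q x) y = inner ℂ x (U (-q) y) := by
  have h := hU.inner_apply q 0 x y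
  rw [hU.zero] at h
  simpa using h

theorem norm_inner_le (hU : IsWeylSystem c U) (q : ℝ × ℝ) (x y : H) :
    ‖inner ℂ x (U q y)‖ ≤ ‖x‖ * ‖y‖ :=
  (norm_inner_le_norm _ _).trans (by rw [hU.norm_apply])

/-- Regularized Wigner functions of pairs of vectors are uniformly bounded. -/
theorem norm_integral_gauss_mul_inner_le [CompleteSpace H] (hU : IsWeylSystem c U) (hc : c ≠ 0)
    (p : ℝ × ℝ) (ξ ψ : H) {ε : ℝ} (hε : 0 < ε) :
    ‖∫ q : ℝ × ℝ, (gauss ε q : ℂ) *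
      (Complex.exp (-(Complex.I * ((q.1 * p.1 + q.2 * p.2 : ℝ) : ℂ))) * inner ℂ ξ (U q ψ))‖ ≤
      2 * Real.pi / |c| * (‖ξ‖ * ‖ψ‖) := by
  let θ : ℝ × ℝ → ℂ := fun q => Complex.exp (-(Complex.I * ((q.1 * p.1 + q.2 * p.2 : ℝ) : ℂ)))
  have hθ : ∀ q, ‖θ q‖ = 1 := fun q => by
    rw [show θ q = Complex.exp (((-(q.1 * p.1 + q.2 * p.2) : ℝ) : ℂ) * Complex.I) by
      simp only [θ]; congr 1; push_cast; ring]
    exact Complex.norm_exp_ofReal_mul_I _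
  have hηc : Continuous fun q => θ q • U q ψ := by
    have := hU.continuous ψ
    simp only [θ]
    fun_prop
  have h0 : θ 0 • U 0 ψ = ψ := by simp [θ, hU.zero]
  have hb := norm_integral_gauss_smul_le hc hηc (fun q q' => by
    rw [h0, inner_smul_left, inner_smul_right, inner_smul_right, hU.inner_apply]
    have : (starRingEnd ℂ) (θ q) * θ q' = θ (q' - q) := by
      simp only [θ]
      rw [← Complex.exp_conj, ← Complex.exp_add]
      congr 1
      simp only [map_neg, map_mul, Complex.conj_I, Complex.conj_ofReal, Prod.fst_sub, Prod.snd_sub]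
      push_cast
      ring
    rw [← this]
    ring) hε
  rw [h0] at hb
  have hint := integrable_gauss_smul hηc (C := ‖ψ‖)
    (fun q => by rw [norm_smul, hθ, one_mul, hU.norm_apply]) hε
  have heq : ∫ q : ℝ × ℝ, (gauss ε q : ℂ) * (θ q * inner ℂ ξ (U q ψ)) =
      inner ℂ ξ (∫ q, (gauss ε q : ℂ) • θ q • U q ψ) := by
    rw [← integral_inner hint]
    simp only [inner_smul_right]
  rw [heq]
  refine (norm_inner_le_norm _ _).trans ?_
  rw [mul_left_comm]
  exact mul_le_mul_of_nonneg_left hb (norm_nonneg _)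

/-- Products of two matrix elements have uniformly bounded Gaussian averages: the operators
`U(q) ⊗ U(-q)` satisfy the Weyl relations with parameter `2c`. -/
theorem norm_integral_gauss_mul_inner_mul_inner_le (hU : IsWeylSystem c U)
    (hc : c ≠ 0) (ξ ψ ξ' ψ' : H) {ε : ℝ} (hε : 0 < ε) :
    ‖∫ q : ℝ × ℝ, (gauss ε q : ℂ) *
      (inner ℂ ξ (U q ψ) * (starRingEnd ℂ) (inner ℂ ξ' (U q ψ')))‖ ≤
      Real.pi / |c| * ((‖ξ‖ * ‖ψ‖) * (‖ξ'‖ * ‖ψ'‖)) := by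
  let η₀ : ℝ × ℝ → H ⊗[ℂ] H := fun q => U q ψ ⊗ₜ[ℂ] U (-q) ξ'
  let η : ℝ × ℝ → UniformSpace.Completion (H ⊗[ℂ] H) := fun q => (η₀ q : _)
  have hη₀c : Continuous η₀ := by
    have h1 := hU.continuous ψ
    have h2 : Continuous fun q => U (-q) ξ' := (hU.continuous ξ').comp continuous_neg
    have h3 : η₀ = fun q => TensorProduct.mkL ℂ H H (U q ψ) (U (-q) ξ') := rfl
    rw [h3]
    exact ((TensorProduct.mkL ℂ H H).continuous.comp h1).clm_apply h2
  have hηc : Continuous η := (UniformSpace.Completion.continuous_coe _).comp hη₀c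
  have hb := norm_integral_gauss_smul_le (c := 2 * c) (by simpa using hc) hηc (fun q q' => by
    simp only [η, η₀, UniformSpace.Completion.inner_coe, TensorProduct.inner_tmul, hU.inner_apply,
      neg_zero, hU.zero, one_apply_eq_self, Prod.fst_neg, Prod.snd_neg]
    rw [show -q' - -q = -(q' - q) by abel, mul_mul_mul_comm, ← Complex.exp_add]
    congr 2
    push_cast
    ring) hε
  have h0 : ‖η 0‖ = ‖ψ‖ * ‖ξ'‖ := by
    simp only [η, η₀, UniformSpace.Completion.norm_coe, TensorProduct.norm_tmul, neg_zero, hU.zero,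
      one_apply_eq_self]
  have hint := integrable_gauss_smul hηc (C := ‖ψ‖ * ‖ξ'‖) (fun q => by
    simp only [η, η₀, UniformSpace.Completion.norm_coe, TensorProduct.norm_tmul, hU.norm_apply]
    exact le_rfl) hε
  have heq : ∫ q : ℝ × ℝ, (gauss ε q : ℂ) *
      (inner ℂ ξ (U q ψ) * (starRingEnd ℂ) (inner ℂ ξ' (U q ψ'))) =
      inner ℂ ((ξ ⊗ₜ[ℂ] ψ' : H ⊗[ℂ] H) : UniformSpace.Completion (H ⊗[ℂ] H))
        (∫ q, (gauss ε q : ℂ) • η q) := by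
    rw [← integral_inner hint]
    congr 1; ext q
    simp only [inner_smul_right, η, η₀, UniformSpace.Completion.inner_coe, TensorProduct.inner_tmul]
    rw [inner_conj_symm, hU.inner_apply_left]
  rw [heq]
  refine (norm_inner_le_norm _ _).trans ?_
  rw [UniformSpace.Completion.norm_coe, TensorProduct.norm_tmul]
  refine (mul_le_mul_of_nonneg_left hb (by positivity)).trans (le_of_eq ?_)
  rw [h0, abs_mul, abs_two]
  field_simp

end IsWeylSystem

end WeylSystem

/-! ### Characteristic functions of nuclear operators -/

section Characteristic

universe v

variable {H : Type v} [NormedAddCommGroup H] [InnerProductSpace ℂ H] [CompleteSpace H]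
  {c : ℝ} {U : ℝ × ℝ → H →L[ℂ] H} {ι : Type v} {A : H →L[ℂ] H} {ξ ψ : ι → H}

/-- The function `q ↦ tr (A U(q))`. -/
noncomputable def charFn (U : ℝ × ℝ → H →L[ℂ] H) (A : H →L[ℂ] H) (q : ℝ × ℝ) : ℂ :=
  trace (A * U q)

namespace IsWeylSystem

theorem hasSum_charFn (hA : IsNuclear A ξ ψ) (q : ℝ × ℝ) :
    HasSum (fun i => inner ℂ (ξ i) (U q (ψ i))) (charFn U A q) :=
  hA.hasSum_inner _

theorem continuous_charFn (hU : IsWeylSystem c U) (hA : IsNuclear A ξ ψ) :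
    Continuous (charFn U A) := by
  have h : charFn U A = fun q => ∑' i, inner ℂ (ξ i) (U q (ψ i)) := by
    ext q; exact (hasSum_charFn hA q).tsum_eq.symm
  rw [h]
  exact continuous_tsum (fun i => continuous_const.inner (hU.continuous (ψ i))) hA.summable
    fun i q => hU.norm_inner_le q _ _

theorem norm_charFn_le (hU : IsWeylSystem c U) (hA : IsNuclear A ξ ψ) (q : ℝ × ℝ) :
    ‖charFn U A q‖ ≤ ∑' i, ‖ξ i‖ * ‖ψ i‖ := by
  rw [← (hasSum_charFn hA q).tsum_eq]
  exact tsum_of_norm_bounded hA.summable.hasSum fun i => hU.norm_inner_le q _ _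

theorem hasSum_integral_charFn [Countable ι] (hU : IsWeylSystem c U) (hA : IsNuclear A ξ ψ)
    {f : ℝ × ℝ → ℂ} (hf : Integrable f) :
    HasSum (fun i => ∫ q, f q * inner ℂ (ξ i) (U q (ψ i))) (∫ q, f q * charFn U A q) := by
  have hb : ∀ i, ∀ᵐ q : ℝ × ℝ, ‖inner ℂ (ξ i) (U q (ψ i))‖ ≤ ‖ξ i‖ * ‖ψ i‖ := fun i =>
    Filter.Eventually.of_forall fun q => hU.norm_inner_le q _ _
  have hint : ∀ i, Integrable fun q => f q * inner ℂ (ξ i) (U q (ψ i)) := fun i =>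
    hf.mul_bdd (continuous_const.inner (hU.continuous (ψ i))).aestronglyMeasurable (hb i)
  have h := hasSum_integral_of_summable_integral_norm hint
    (Summable.of_nonneg_of_le (fun i => integral_nonneg fun q => norm_nonneg _) (fun i => ?_)
      (hA.summable.mul_left (∫ q, ‖f q‖)))
  · have heq : ∀ q, ∑' i, f q * inner ℂ (ξ i) (U q (ψ i)) = f q * charFn U A q := fun q =>
      ((hasSum_charFn hA q).mul_left _).tsum_eq
    simpa only [heq] using h
  · rw [← integral_mul_const]
    refine integral_mono (hint i).norm (hf.norm.mul_const _) fun q => ?_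
    beta_reduce
    rw [norm_mul]
    exact mul_le_mul_of_nonneg_left (hU.norm_inner_le q _ _) (norm_nonneg _)

/-- Regularized Wigner functions of nuclear operators are uniformly bounded. -/
theorem norm_integral_gauss_mul_charFn_le [Countable ι] (hU : IsWeylSystem c U)
    (hA : IsNuclear A ξ ψ) (hc : c ≠ 0) (p : ℝ × ℝ) {ε : ℝ} (hε : 0 < ε) :
    ‖∫ q : ℝ × ℝ, (gauss ε q : ℂ) *
      (Complex.exp (-(Complex.I * ((q.1 * p.1 + q.2 * p.2 : ℝ) : ℂ))) * charFn U A q)‖ ≤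
      2 * Real.pi / |c| * ∑' i, ‖ξ i‖ * ‖ψ i‖ := by
  have hf : Integrable fun q : ℝ × ℝ => (gauss ε q : ℂ) *
      Complex.exp (-(Complex.I * ((q.1 * p.1 + q.2 * p.2 : ℝ) : ℂ))) := by
    refine (integrable_gauss_smul (F := ℂ) (C := 1)
      (η := fun q : ℝ × ℝ => Complex.exp (-(Complex.I * ((q.1 * p.1 + q.2 * p.2 : ℝ) : ℂ))))
      (by fun_prop) (fun q => ?_) hε)
    rw [show -(Complex.I * ((q.1 * p.1 + q.2 * p.2 : ℝ) : ℂ)) =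
      ((-(q.1 * p.1 + q.2 * p.2) : ℝ) : ℂ) * Complex.I by push_cast; ring]
    exact (Complex.norm_exp_ofReal_mul_I _).le
  have h := hU.hasSum_integral_charFn hA hf
  simp only [mul_assoc] at h ⊢
  rw [← h.tsum_eq]
  refine tsum_of_norm_bounded (hA.summable.hasSum.mul_left _) fun i => ?_
  exact hU.norm_integral_gauss_mul_inner_le hc p (ξ i) (ψ i) hε

/-- The regularized `L²`-norm of a characteristic function is bounded uniformly in `ε`: the nuclear
series is inserted for one factor of `χ̄ χ` after the other. -/
theorem integral_gauss_mul_norm_sq_charFn_le [Countable ι] (hU : IsWeylSystem c U)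
    (hA : IsNuclear A ξ ψ) (hc : c ≠ 0) {ε : ℝ} (hε : 0 < ε) :
    ∫ q : ℝ × ℝ, gauss ε q * ‖charFn U A q‖ ^ 2 ≤
      Real.pi / |c| * (∑' i, ‖ξ i‖ * ‖ψ i‖) ^ 2 := by
  set S := ∑' i, ‖ξ i‖ * ‖ψ i‖ with hS
  have hcont := hU.continuous_charFn hA
  have h1 : ∀ i, ‖∫ q, ((gauss ε q : ℂ) * (starRingEnd ℂ) (charFn U A q)) *
      inner ℂ (ξ i) (U q (ψ i))‖ ≤ Real.pi / |c| * S * (‖ξ i‖ * ‖ψ i‖) := by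
    intro i
    have hf : Integrable fun q : ℝ × ℝ =>
        (gauss ε q : ℂ) * (starRingEnd ℂ) (inner ℂ (ξ i) (U q (ψ i))) :=
      integrable_gauss_smul (F := ℂ) (C := ‖ξ i‖ * ‖ψ i‖)
        (Complex.continuous_conj.comp (continuous_const.inner (hU.continuous (ψ i))))
        (fun q => by rw [Function.comp_apply, RCLike.norm_conj]; exact hU.norm_inner_le q _ _) hε
    have h := hU.hasSum_integral_charFn hA hf
    have h2 : ‖∫ q, (gauss ε q : ℂ) * (starRingEnd ℂ) (inner ℂ (ξ i) (U q (ψ i))) *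
        charFn U A q‖ ≤ Real.pi / |c| * (‖ξ i‖ * ‖ψ i‖) * S := by
      rw [← h.tsum_eq]
      refine tsum_of_norm_bounded (hA.summable.hasSum.mul_left _) fun j => ?_
      have h3 := hU.norm_integral_gauss_mul_inner_mul_inner_le hc (ξ j) (ψ j) (ξ i) (ψ i) hε
      refine (le_of_eq ?_).trans (h3.trans (le_of_eq (by ring)))
      congr 2; ext q; ring
    rw [← RCLike.norm_conj, ← integral_conj]
    refine (le_of_eq ?_).trans (h2.trans (le_of_eq (by ring)))
    congr 2; ext q
    simp only [map_mul, Complex.conj_conj, Complex.conj_ofReal]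
    ring
  have hf : Integrable fun q : ℝ × ℝ => (gauss ε q : ℂ) * (starRingEnd ℂ) (charFn U A q) :=
    integrable_gauss_smul (F := ℂ) (C := S) (Complex.continuous_conj.comp hcont)
      (fun q => by rw [Function.comp_apply, RCLike.norm_conj]; exact hU.norm_charFn_le hA q) hε
  have h := hU.hasSum_integral_charFn hA hf
  have h2 : ‖∫ q, (gauss ε q : ℂ) * (starRingEnd ℂ) (charFn U A q) * charFn U A q‖ ≤
      Real.pi / |c| * S * S := by
    rw [← h.tsum_eq]
    exact tsum_of_norm_bounded (hA.summable.hasSum.mul_left _) h1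
  have h3 : ∫ q, (gauss ε q : ℂ) * (starRingEnd ℂ) (charFn U A q) * charFn U A q =
      ((∫ q, gauss ε q * ‖charFn U A q‖ ^ 2 : ℝ) : ℂ) := by
    rw [← integral_complex_ofReal]
    congr 1; ext q
    rw [mul_assoc, RCLike.conj_mul]
    push_cast
    rfl
  rw [h3, Complex.norm_real, Real.norm_eq_abs] at h2
  exact (le_abs_self _).trans (h2.trans (le_of_eq (by ring)))

/-- Characteristic functions of nuclear operators are square integrable. -/
theorem memLp_charFn [Countable ι] (hU : IsWeylSystem c U) (hA : IsNuclear A ξ ψ) (hc : c ≠ 0) :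
    MemLp (charFn U A) 2 := by
  set K := Real.pi / |c| * (∑' i, ‖ξ i‖ * ‖ψ i‖) ^ 2 with hK
  have hcont := hU.continuous_charFn hA
  rw [memLp_two_iff_integrable_sq_norm hcont.aestronglyMeasurable]
  refine ⟨(hcont.norm.pow 2).aestronglyMeasurable, ?_⟩
  rw [hasFiniteIntegral_iff_ofReal (Filter.Eventually.of_forall fun q => by positivity)]
  have hε : ∀ n : ℕ, 0 < 1 / ((n : ℝ) + 1) := fun n => by positivity
  have hlim := lintegral_tendsto_of_tendsto_of_monotone (μ := (volume : Measure (ℝ × ℝ)))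
    (f := fun (n : ℕ) q => ENNReal.ofReal (gauss (1 / ((n : ℝ) + 1)) q * ‖charFn U A q‖ ^ 2))
    (F := fun q => ENNReal.ofReal (‖charFn U A q‖ ^ 2)) (fun n => by
      refine (ENNReal.continuous_ofReal.comp ?_).measurable.aemeasurable
      exact (continuous_gauss _).mul (hcont.norm.pow 2))
    (Filter.Eventually.of_forall fun q m n hmn => by
      refine ENNReal.ofReal_le_ofReal (mul_le_mul_of_nonneg_right (Real.exp_le_exp.2 ?_)
        (by positivity))
      have h1 := one_div_le_one_div_of_le (by positivity : (0 : ℝ) < m + 1)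
        (by exact_mod_cast Nat.succ_le_succ hmn : (m : ℝ) + 1 ≤ n + 1)
      have := mul_le_mul_of_nonneg_right h1 (by positivity : 0 ≤ q.1 ^ 2 + q.2 ^ 2)
      linarith)
    (Filter.Eventually.of_forall fun q => by
      refine (ENNReal.continuous_ofReal.tendsto _).comp ?_
      have h1 : Filter.Tendsto (fun n : ℕ => gauss (1 / ((n : ℝ) + 1)) q) Filter.atTop
          (nhds 1) := by
        have h2 : Continuous fun ε : ℝ => gauss ε q := by unfold gauss; fun_prop
        have h3 := (h2.tendsto 0).comp (tendsto_one_div_add_atTop_nhds_zero_nat (𝕜 := ℝ))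
        have h4 : gauss 0 q = 1 := by simp [gauss]
        rw [h4] at h3
        exact h3
      simpa using h1.mul_const (‖charFn U A q‖ ^ 2))
  refine lt_of_le_of_lt (le_of_tendsto' hlim fun n => ?_) (ENNReal.ofReal_lt_top (r := K))
  have hint : Integrable fun q => gauss (1 / ((n : ℝ) + 1)) q * ‖charFn U A q‖ ^ 2 := by
    have h := integrable_gauss_smul (F := ℂ) (η := fun q => ((‖charFn U A q‖ ^ 2 : ℝ) : ℂ))
      (by fun_prop) (C := (∑' i, ‖ξ i‖ * ‖ψ i‖) ^ 2) (fun q => by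
        rw [Complex.norm_real, Real.norm_eq_abs, abs_of_nonneg (by positivity)]
        exact pow_le_pow_left₀ (norm_nonneg _) (hU.norm_charFn_le hA q) 2) (hε n)
    refine h.re.congr (Filter.Eventually.of_forall fun q => ?_)
    simp only [smul_eq_mul, ← Complex.ofReal_mul]
    exact RCLike.ofReal_re_ax _
  rw [← ofReal_integral_eq_lintegral_ofReal hint (Filter.Eventually.of_forall fun q =>
    mul_nonneg (gauss_pos _ _).le (by positivity))]
  exact ENNReal.ofReal_le_ofReal (hU.integral_gauss_mul_norm_sq_charFn_le hA hc (hε n))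

end IsWeylSystem

end Characteristic

/-! ### Fourier transforms of functions on the plane -/

section Fourier

open WithLp FourierTransform

/-- The Euclidean plane, whose norm is Hilbertian (that of `ℝ × ℝ` is the sup norm). -/
abbrev Plane : Type := WithLp 2 (ℝ × ℝ)

/-- A Schwartz function on `ℝ × ℝ`, viewed on the Euclidean plane. -/
noncomputable def toPlane (φ : 𝓢(ℝ × ℝ, ℂ)) : 𝓢(Plane, ℂ) :=
  SchwartzMap.compCLMOfContinuousLinearEquiv ℂ (WithLp.prodContinuousLinearEquiv 2 ℝ ℝ ℝ) φ

theorem toPlane_apply (φ : 𝓢(ℝ × ℝ, ℂ)) (y : Plane) : toPlane φ y = φ (ofLp y) := rfl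

theorem integral_plane_eq {F : Type*} [NormedAddCommGroup F] [NormedSpace ℝ F] (f : ℝ × ℝ → F) :
    ∫ y : Plane, f (ofLp y) = ∫ p, f p :=
  (WithLp.volume_preserving_ofLp ℝ ℝ).integral_comp
    (MeasurableEquiv.toLp 2 (ℝ × ℝ)).symm.measurableEmbedding f

theorem fourier_toPlane (φ : 𝓢(ℝ × ℝ, ℂ)) (y : Plane) :
    𝓕 (toPlane φ) y = (2 * Real.pi : ℝ) * invFourier φ ((2 * Real.pi) • ofLp y) := by
  rw [SchwartzMap.fourier_coe, Real.fourier_eq', invFourier, ← mul_assoc, ← Complex.ofReal_mul,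
    mul_one_div_cancel (by positivity), Complex.ofReal_one, one_mul,
    ← integral_plane_eq (fun p => φ p * Complex.exp (-(Complex.I *
      ((((2 * Real.pi) • ofLp y).1 * p.1 + ((2 * Real.pi) • ofLp y).2 * p.2 : ℝ) : ℂ))))]
  congr 1; ext v
  rw [toPlane_apply, smul_eq_mul, mul_comm, WithLp.prod_inner_apply]
  congr 2
  simp only [RCLike.inner_apply, Prod.smul_fst, Prod.smul_snd, smul_eq_mul]
  simp
  ring

theorem invFourier_eq (φ : 𝓢(ℝ × ℝ, ℂ)) (q : ℝ × ℝ) :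
    invFourier φ q = (2 * Real.pi : ℝ)⁻¹ * 𝓕 (toPlane φ) (toLp 2 ((2 * Real.pi)⁻¹ • q)) := by
  have h : (2 * Real.pi : ℝ) ≠ 0 := by positivity
  rw [fourier_toPlane, ← mul_assoc, ofLp_toLp, smul_inv_smul₀ h,
    ← Complex.ofReal_mul, inv_mul_cancel₀ h, Complex.ofReal_one, one_mul]

theorem integrable_invFourier (φ : 𝓢(ℝ × ℝ, ℂ)) : Integrable (invFourier φ) := by
  have h : invFourier φ = fun q => (2 * Real.pi : ℝ)⁻¹ *
      𝓕 (toPlane φ) (toLp 2 ((2 * Real.pi)⁻¹ • q)) := funext (invFourier_eq φ)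
  rw [h]
  have h1 : Integrable fun q : ℝ × ℝ => 𝓕 (toPlane φ) (toLp 2 q) :=
    (WithLp.volume_preserving_toLp ℝ ℝ).integrable_comp_of_integrable
      (𝓕 (toPlane φ)).integrable
  exact (h1.comp_smul (by positivity : (2 * Real.pi)⁻¹ ≠ 0)).const_mul _

/-- `w` is the Fourier transform of `χ`, in the weak sense with the normalization of the Weyl
calculus. -/
def IsFourierDensity (χ w : ℝ × ℝ → ℂ) : Prop :=
  ∀ φ : 𝓢(ℝ × ℝ, ℂ), ∫ p, φ p * w p = (1 / (2 * Real.pi) : ℝ) * ∫ q, χ q * invFourier φ q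

theorem exists_memLp_two_isFourierDensity {χ : ℝ × ℝ → ℂ} (hχ : Continuous χ) (h2 : MemLp χ 2) :
    ∃ w, MemLp w 2 ∧ IsFourierDensity χ w := by
  have hpi : (2 * Real.pi : ℝ) ≠ 0 := by positivity
  have hs : MemLp (fun p : ℝ × ℝ => χ ((2 * Real.pi) • p)) 2 := by
    have hc : Continuous fun p : ℝ × ℝ => χ ((2 * Real.pi) • p) := hχ.comp (continuous_const_smul _)
    rw [memLp_two_iff_integrable_sq_norm hc.aestronglyMeasurable]
    exact ((memLp_two_iff_integrable_sq_norm hχ.aestronglyMeasurable).1 h2).comp_smul hpi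
  have hf : MemLp (fun y : Plane => χ ((2 * Real.pi) • ofLp y)) 2 :=
    hs.comp_measurePreserving (WithLp.volume_preserving_ofLp ℝ ℝ)
  set F := hf.toLp _ with hF
  refine ⟨fun p => (𝓕 F : Lp ℂ 2 (volume : Measure Plane)) (toLp 2 p),
    (Lp.memLp (𝓕 F)).comp_measurePreserving (WithLp.volume_preserving_toLp ℝ ℝ), fun φ => ?_⟩
  have key := DFunLike.congr_fun (Lp.fourier_toTemperedDistribution_eq F) (toPlane φ)
  rw [TemperedDistribution.fourier_apply, Lp.toTemperedDistribution_apply,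
    Lp.toTemperedDistribution_apply] at key
  rw [← integral_plane_eq (fun p => φ p *
    (𝓕 F : Lp ℂ 2 (volume : Measure Plane)) (toLp 2 p))]
  refine key.symm.trans ?_
  have h1 : ∫ y, 𝓕 (toPlane φ) y • F y = ∫ y : Plane, (fun p : ℝ × ℝ =>
      (2 * Real.pi : ℝ) * invFourier φ ((2 * Real.pi) • p) * χ ((2 * Real.pi) • p)) (ofLp y) := by
    refine integral_congr_ae ?_
    filter_upwards [hf.coeFn_toLp] with y hy
    rw [hF, hy, fourier_toPlane, smul_eq_mul]
  rw [h1, integral_plane_eq (fun p : ℝ × ℝ =>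
    (2 * Real.pi : ℝ) * invFourier φ ((2 * Real.pi) • p) * χ ((2 * Real.pi) • p)), Measure.integral_comp_smul volume
    (fun p : ℝ × ℝ => ((2 * Real.pi : ℝ) : ℂ) * invFourier φ p * χ p)]
  simp only [mul_assoc, integral_const_mul]
  simp only [Module.finrank_prod, Module.finrank_self]
  rw [abs_of_pos (by positivity), Complex.real_smul, ← mul_assoc]
  congr 1
  · rw [← Complex.ofReal_mul]
    congr 1
    field_simp
    ring
  · simp only [mul_comm]

/-- A locally integrable function that acts on test functions with `L¹`-norm bound `C` is bounded by
`C` almost everywhere, by convolution with a smooth approximation of the identity. -/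
theorem ae_norm_le_of_norm_integral_le {w : ℝ × ℝ → ℂ} (hw : LocallyIntegrable w) {C : ℝ}
    (hC : ∀ φ : 𝓢(ℝ × ℝ, ℂ), ‖∫ p, φ p * w p‖ ≤ C * ∫ p, ‖φ p‖) : ∀ᵐ p, ‖w p‖ ≤ C := by
  let b : ℕ → ContDiffBump (0 : ℝ × ℝ) := fun n =>
    ⟨1 / ((n : ℝ) + 1), 2 * (1 / ((n : ℝ) + 1)), by positivity, by
      have : 0 < 1 / ((n : ℝ) + 1) := by positivity
      linarith⟩
  have hr : Filter.Tendsto (fun n => (b n).rOut) Filter.atTop (nhds 0) := by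
    have h := (tendsto_one_div_add_atTop_nhds_zero_nat (𝕜 := ℝ)).const_mul 2
    rwa [mul_zero] at h
  filter_upwards [ContDiffBump.ae_convolution_tendsto_right_of_locallyIntegrable hr
    (K := 2) (Filter.Eventually.of_forall fun n => le_rfl) hw] with x hx
  refine le_of_tendsto hx.norm (Filter.Eventually.of_forall fun n => ?_)
  have hsm : ContDiff ℝ ((⊤ : ℕ∞) : WithTop ℕ∞) fun t => (((b n).normed volume (x - t) : ℝ) : ℂ) :=
    Complex.ofRealCLM.contDiff.comp ((b n).contDiff_normed.comp (contDiff_const.sub contDiff_id))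
  have hcs : HasCompactSupport fun t => (((b n).normed volume (x - t) : ℝ) : ℂ) :=
    ((b n).hasCompactSupport_normed.comp_homeomorph (Homeomorph.subLeft x)).comp_left
      Complex.ofReal_zero
  have h := hC (hcs.toSchwartzMap hsm)
  rw [convolution_eq_swap]
  have h1 : ∫ p, ‖(hcs.toSchwartzMap hsm) p‖ = 1 := by
    have h2 : ∀ p, ‖(hcs.toSchwartzMap hsm) p‖ = (b n).normed volume (x - p) := fun p => by
      rw [HasCompactSupport.toSchwartzMap_toFun, Complex.norm_real, Real.norm_eq_abs,
        abs_of_nonneg ((b n).nonneg_normed _)]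
    simp only [h2]
    rw [integral_sub_left_eq_self (fun t => (b n).normed volume t) volume x, (b n).integral_normed]
  rw [h1, mul_one] at h
  refine (le_of_eq ?_).trans h
  congr 2

/-- If the Gaussian regularizations of `χ` have uniformly bounded Fourier transforms, then the
Fourier transform of `χ` is bounded. -/
theorem IsFourierDensity.ae_norm_le {χ w : ℝ × ℝ → ℂ} (h : IsFourierDensity χ w)
    (hw : LocallyIntegrable w) (hχ : Continuous χ) {K : ℝ} (hK : ∀ q, ‖χ q‖ ≤ K) {C : ℝ}
    (hC : ∀ ε > 0, ∀ p : ℝ × ℝ, ‖∫ q : ℝ × ℝ, (gauss ε q : ℂ) *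
      (Complex.exp (-(Complex.I * ((q.1 * p.1 + q.2 * p.2 : ℝ) : ℂ))) * χ q)‖ ≤ C) :
    ∃ C', ∀ᵐ p, ‖w p‖ ≤ C' := by
  refine ⟨1 / (2 * Real.pi) * (1 / (2 * Real.pi) * C), ae_norm_le_of_norm_integral_le hw fun φ => ?_⟩
  let e : ℝ × ℝ → ℝ × ℝ → ℂ := fun q p =>
    Complex.exp (-(Complex.I * ((q.1 * p.1 + q.2 * p.2 : ℝ) : ℂ)))
  have he : ∀ q p, ‖e q p‖ = 1 := fun q p => by
    rw [show e q p = Complex.exp (((-(q.1 * p.1 + q.2 * p.2) : ℝ) : ℂ) * Complex.I) by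
      simp only [e]; congr 1; push_cast; ring]
    exact Complex.norm_exp_ofReal_mul_I _
  have hreg : ∀ ε > 0, ‖∫ q, (gauss ε q : ℂ) * (χ q * invFourier φ q)‖ ≤
      1 / (2 * Real.pi) * C * ∫ p, ‖φ p‖ := by
    intro ε hε
    have hg : Integrable fun q => (gauss ε q : ℂ) * χ q := integrable_gauss_smul (F := ℂ) hχ hK hε
    have hint : Integrable (Function.uncurry fun q p : ℝ × ℝ =>
        ((gauss ε q : ℂ) * χ q) * (φ p * e q p)) ((volume : Measure (ℝ × ℝ)).prod volume) := by
      have h1 := hg.mul_prod φ.integrable (μ := volume) (ν := volume)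
      have h2 : Continuous fun z : (ℝ × ℝ) × (ℝ × ℝ) => e z.1 z.2 := by
        simp only [e]; fun_prop
      refine (h1.mul_bdd (g := fun z : (ℝ × ℝ) × (ℝ × ℝ) => e z.1 z.2) (c := 1)
        h2.aestronglyMeasurable (Filter.Eventually.of_forall fun z => (he _ _).le)).congr
        (Filter.Eventually.of_forall fun z => ?_)
      simp only [Function.uncurry]
      ring
    have h3 : ∫ q, (gauss ε q : ℂ) * (χ q * invFourier φ q) = (1 / (2 * Real.pi) : ℝ) *
        ∫ p, φ p * ∫ q, (gauss ε q : ℂ) * (e q p * χ q) := by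
      have h4 : ∀ q, (gauss ε q : ℂ) * (χ q * invFourier φ q) = (1 / (2 * Real.pi) : ℝ) *
          ∫ p, ((gauss ε q : ℂ) * χ q) * (φ p * e q p) := fun q => by
        rw [invFourier, integral_const_mul]
        simp only [e]
        ring
      simp only [h4]
      rw [integral_const_mul, integral_integral_swap hint]
      congr 2; ext p
      rw [← integral_const_mul]
      congr 1; ext q
      ring
    rw [h3, norm_mul, Complex.norm_real, Real.norm_eq_abs, abs_of_pos (by positivity), mul_assoc]
    refine mul_le_mul_of_nonneg_left ?_ (by positivity)
    rw [← integral_const_mul]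
    refine norm_integral_le_of_norm_le (φ.integrable.norm.const_mul C)
      (Filter.Eventually.of_forall fun p => ?_)
    rw [norm_mul, mul_comm]
    exact mul_le_mul_of_nonneg_right (hC ε hε p) (norm_nonneg _)
  have hφi : Integrable fun q => χ q * invFourier φ q :=
    ((integrable_invFourier φ).mul_bdd hχ.aestronglyMeasurable
      (Filter.Eventually.of_forall hK)).congr
      (Filter.Eventually.of_forall fun q => mul_comm _ _)
  have hlim : Filter.Tendsto (fun n : ℕ => ∫ q, (gauss (1 / ((n : ℝ) + 1)) q : ℂ) *
      (χ q * invFourier φ q)) Filter.atTop (nhds (∫ q, χ q * invFourier φ q)) := by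
    refine tendsto_integral_of_dominated_convergence (fun q => ‖χ q * invFourier φ q‖) (fun n => ?_)
      hφi.norm (fun n => Filter.Eventually.of_forall fun q => ?_)
      (Filter.Eventually.of_forall fun q => ?_)
    · exact (Complex.continuous_ofReal.comp (continuous_gauss _)).aestronglyMeasurable.mul
        hφi.aestronglyMeasurable
    · rw [norm_mul, Complex.norm_real, Real.norm_eq_abs, abs_of_pos (gauss_pos _ _)]
      exact mul_le_of_le_one_left (norm_nonneg _) (gauss_le_one (by positivity) _)
    · have h2 : Continuous fun ε : ℝ => (gauss ε q : ℂ) * (χ q * invFourier φ q) := by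
        unfold gauss; fun_prop
      have h3 := (h2.tendsto 0).comp (tendsto_one_div_add_atTop_nhds_zero_nat (𝕜 := ℝ))
      have h4 : gauss 0 q = 1 := by simp [gauss]
      simpa [h4, Function.comp_def] using h3
  have hlim2 := le_of_tendsto hlim.norm (Filter.Eventually.of_forall fun n : ℕ =>
    hreg (1 / ((n : ℝ) + 1)) (by positivity))
  rw [h φ, norm_mul, Complex.norm_real, Real.norm_eq_abs, abs_of_pos (by positivity), mul_assoc]
  exact mul_le_mul_of_nonneg_left hlim2 (by positivity)

end Fourier

universe u

/-! ### Operators determined by exponential vectors -/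

section ExpVec

variable {K : Type u} [NormedAddCommGroup K] [InnerProductSpace ℂ K]

theorem ext_inner_expVec {x y : Fock K} (h : ∀ f, inner ℂ (expVec f) x = inner ℂ (expVec f) y) :
    x = y := by
  rw [← sub_eq_zero]
  refine eq_zero_of_inner_expVec fun f => ?_
  rw [← inner_conj_symm, inner_sub_right, h, sub_self, map_zero]

theorem ext_expVec {A B : Fock K →L[ℂ] Fock K} (h : ∀ f, A (expVec f) = B (expVec f)) : A = B := by
  refine ContinuousLinearMap.ext (congrFun ?_)
  refine denseRange_expVec.equalizer A.continuous B.continuous (funext fun c => ?_)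
  simp only [Function.comp_apply, Finsupp.linearCombination_apply, Finsupp.sum, map_sum, map_smul, h]

theorem ext_expVec₂ {A B : Fock K →L[ℂ] Fock K}
    (h : ∀ f g, inner ℂ (expVec f) (A (expVec g)) = inner ℂ (expVec f) (B (expVec g))) : A = B :=
  ext_expVec fun g => ext_inner_expVec fun f => h f g

/-- Uniformly bounded operators that converge on exponential vectors converge strongly. -/
theorem tendsto_of_tendsto_expVec {α : Type*} {l : Filter α} {T : α → Fock K →L[ℂ] Fock K}
    {S : Fock K →L[ℂ] Fock K} {C : ℝ} (hC : ∀ a, ‖T a‖ ≤ C)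
    (h : ∀ f, Filter.Tendsto (fun a => T a (expVec f)) l (nhds (S (expVec f)))) (x : Fock K) :
    Filter.Tendsto (fun a => T a x) l (nhds (S x)) := by
  have hlc : ∀ c, Filter.Tendsto (fun a => T a (Finsupp.linearCombination ℂ expVec c)) l
      (nhds (S (Finsupp.linearCombination ℂ expVec c))) := by
    intro c
    simp only [Finsupp.linearCombination_apply, Finsupp.sum, map_sum, map_smul]
    exact tendsto_finsetSum _ fun f _ => (h f).const_smul _
  rw [Metric.tendsto_nhds]
  intro ε hε
  have hD : 0 < |C| + ‖S‖ + 1 := by positivity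
  obtain ⟨c, hc⟩ := denseRange_expVec.exists_dist_lt x
    (by positivity : 0 < ε / 2 / (|C| + ‖S‖ + 1))
  set y := Finsupp.linearCombination ℂ (expVec (K := K)) c
  filter_upwards [Metric.tendsto_nhds.1 (hlc c) (ε / 2) (by positivity)] with a ha
  rw [dist_eq_norm] at hc ha ⊢
  have h1 : T a x - S x = T a (x - y) + (T a y - S y) - S (x - y) := by
    simp only [map_sub]; abel
  have h2 : ‖T a (x - y)‖ ≤ |C| * ‖x - y‖ :=
    (T a).le_of_opNorm_le ((hC a).trans (le_abs_self C)) _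
  have h3 := S.le_opNorm (x - y)
  have h4 : (|C| + ‖S‖ + 1) * ‖x - y‖ < ε / 2 := by
    rw [lt_div_iff₀ hD] at hc; linarith
  rw [h1]
  have h5 := norm_sub_le (T a (x - y) + (T a y - S y)) (S (x - y))
  have h6 := norm_add_le (T a (x - y)) (T a y - S y)
  nlinarith [norm_nonneg (x - y)]

theorem continuous_expVec : Continuous (expVec : K → Fock K) := by
  rw [continuous_iff_continuousAt]
  intro g
  have h1 : ∀ f : K, ‖expVec f - expVec g‖ = √(RCLike.re (Complex.exp (inner ℂ f f) -
      Complex.exp (inner ℂ f g) - Complex.exp (inner ℂ g f) + Complex.exp (inner ℂ g g))) := by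
    intro f
    rw [@norm_eq_sqrt_re_inner ℂ]
    congr 2
    simp only [inner_sub_left, inner_sub_right, inner_expVec]
    ring
  rw [ContinuousAt, tendsto_iff_norm_sub_tendsto_zero]
  simp only [h1]
  have h2 : Continuous fun f : K => √(RCLike.re (Complex.exp (inner ℂ f f) -
      Complex.exp (inner ℂ f g) - Complex.exp (inner ℂ g f) + Complex.exp (inner ℂ g g))) := by
    fun_prop
  have h3 := h2.tendsto g
  simpa using h3

end ExpVec

/-! ### The Weyl operators form a Weyl system -/

section Weyl

variable {E : Type u} [NormedAddCommGroup E] [InnerProductSpace ℝ E]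

/-- The vector `u h₁ + i v h₂`. -/
def displacement (h : E × E) (q : ℝ × ℝ) : Cplx E := Cplx.mk (q.1 • h.1) (q.2 • h.2)

/-- The Weyl operators `U(u h₁, v h₂)` as a family over the plane. -/
noncomputable def weylFamily (h : E × E) (q : ℝ × ℝ) : BddOp E := weyl (q.1 • h.1) (q.2 • h.2)

theorem weylFamily_expVec (h : E × E) (q : ℝ × ℝ) (f : Cplx E) :
    weylFamily h q (expVec f) = weylExp (displacement h q) f := weyl_expVec _ _ _

theorem displacement_sub (h : E × E) (q q' : ℝ × ℝ) :
    displacement h (q' - q) = displacement h q' - displacement h q :=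
  Cplx.ext' (sub_smul _ _ _) (sub_smul _ _ _)

theorem displacement_zero (h : E × E) : displacement h 0 = 0 :=
  Cplx.ext' (zero_smul _ _) (zero_smul _ _)

theorem displacement_neg (h : E × E) (q : ℝ × ℝ) : displacement h (-q) = -displacement h q :=
  Cplx.ext' (neg_smul _ _) (neg_smul _ _)

theorem inner_displacement_sub_inner (h : E × E) (q q' : ℝ × ℝ) :
    inner ℂ (displacement h q) (displacement h q') - inner ℂ (displacement h q') (displacement h q) =
      2 * (Complex.I * ((inner ℝ h.1 h.2 * (q.1 * q'.2 - q.2 * q'.1) : ℝ) : ℂ)) := by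
  rw [Cplx.inner_def, Cplx.inner_def]
  apply Complex.ext
  · simp [displacement, real_inner_smul_left, real_inner_smul_right]
    ring
  · simp [displacement, real_inner_smul_left, real_inner_smul_right, real_inner_comm h.1 h.2]
    ring

theorem norm_sq_eq_inner (z : Cplx E) : (‖z‖ : ℂ) ^ 2 = inner ℂ z z :=
  (inner_self_eq_norm_sq_to_K z).symm

theorem norm_weyl_apply (h₁ h₂ : E) (x : Fock (Cplx E)) : ‖weyl h₁ h₂ x‖ = ‖x‖ := by
  refine congrFun (denseRange_expVec.equalizer (weyl h₁ h₂).continuous.norm continuous_norm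
    (funext fun c => ?_)) x
  have h1 : weyl h₁ h₂ (Finsupp.linearCombination ℂ expVec c) =
      Finsupp.linearCombination ℂ (weylExp (Cplx.mk h₁ h₂)) c := by
    simp only [Finsupp.linearCombination_apply, Finsupp.sum, map_sum, map_smul, weyl_expVec]
  simp only [Function.comp_apply]
  rw [h1, norm_weyl_comb]

theorem isWeylSystem_weylFamily (h : E × E) :
    IsWeylSystem (inner ℝ h.1 h.2) (weylFamily h) where
  zero := ext_expVec fun f => by
    rw [weylFamily_expVec, displacement_zero, weylExp]
    simp
  inner_apply q q' x y := by
    have key : ContinuousLinearMap.adjoint (weylFamily h q) * weylFamily h q' =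
        Complex.exp (Complex.I * ((inner ℝ h.1 h.2 * (q.1 * q'.2 - q.2 * q'.1) : ℝ) : ℂ)) •
          weylFamily h (q' - q) := by
      refine ext_expVec₂ fun f g => ?_
      rw [mul_apply_eq_comp, ContinuousLinearMap.adjoint_inner_right, smul_apply,
        weylFamily_expVec, weylFamily_expVec, weylFamily_expVec, displacement_sub, weylExp, weylExp,
        weylExp, inner_smul_left, inner_smul_right, inner_smul_right, inner_smul_right,
        inner_expVec, inner_expVec, ← Complex.exp_conj, ← Complex.exp_add, ← Complex.exp_add,
        ← Complex.exp_add, ← Complex.exp_add]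
      congr 1
      have h1 := inner_displacement_sub_inner h q q'
      simp only [map_sub, map_neg, map_div₀, map_ofNat, inner_conj_symm,
        norm_sq_eq_inner, inner_add_left, inner_add_right, inner_sub_left,
        inner_sub_right]
      linear_combination h1 / 2
    rw [← ContinuousLinearMap.adjoint_inner_right, ← mul_apply_eq_comp, key, smul_apply,
      inner_smul_right]
  continuous x := by
    rw [continuous_iff_continuousAt]
    intro q
    refine tendsto_of_tendsto_expVec (C := 1) (fun q => ContinuousLinearMap.opNorm_le_bound _
      zero_le_one fun x => ?_) (fun f => ?_) x
    · rw [one_mul]; exact (norm_weyl_apply _ _ _).le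
    · have hd : Continuous (displacement h) := by
        have h1 : displacement h = fun q => ((q.1 : ℝ) : ℂ) • Cplx.ofReal h.1 +
            ((q.2 : ℝ) : ℂ) • Complex.I • Cplx.ofReal h.2 := by
          funext q
          apply Cplx.ext'
          · simp only [displacement, Cplx.ofReal, Cplx.re_add, Cplx.re_smul, Cplx.im_smul,
              Cplx.re_mk, Cplx.im_mk]
            simp
          · simp only [displacement, Cplx.ofReal, Cplx.im_add, Cplx.re_smul, Cplx.im_smul,
              Cplx.re_mk, Cplx.im_mk]
            simp
        rw [h1]
        fun_prop
      have hc : Continuous fun q => weylFamily h q (expVec f) := by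
        simp only [weylFamily_expVec, weylExp]
        have := continuous_expVec (K := Cplx E)
        fun_prop
      exact hc.tendsto q

end Weyl

/-! ### Regularized field operators -/

section Regularization

variable {K : Type u} [NormedAddCommGroup K] [InnerProductSpace ℂ K]

/-- Uniformly bounded operators between the particle levels assemble to a bounded operator. -/
theorem exists_levelOp {m : ℕ → ℕ} (hm : Function.Injective m) (T : ∀ n, Sym K (m n) →L[ℂ] Sym K n)
    {C : ℝ} (hC : ∀ n, ‖T n‖ ≤ C) :
    ∃ L : Fock K →L[ℂ] Fock K, ‖L‖ ≤ C ∧ ∀ ψ n, L ψ n = T n (ψ (m n)) := by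
  have hC0 : 0 ≤ C := (norm_nonneg _).trans (hC 0)
  have hs : ∀ ψ : Fock K, HasSum (fun n => ‖ψ n‖ ^ 2) (‖ψ‖ ^ 2) := fun ψ => by
    simpa using lp.hasSum_norm (p := 2) (by norm_num) ψ
  have hle : ∀ (ψ : Fock K) n, ‖T n (ψ (m n))‖ ^ 2 ≤ C ^ 2 * ‖ψ (m n)‖ ^ 2 := fun ψ n => by
    rw [← mul_pow]
    exact pow_le_pow_left₀ (norm_nonneg _) ((T n).le_of_opNorm_le (hC n) _) 2
  have hsm : ∀ ψ : Fock K, Summable fun n => C ^ 2 * ‖ψ (m n)‖ ^ 2 := fun ψ =>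
    ((hs ψ).summable.comp_injective hm).mul_left _
  let L₀ : Fock K →ₗ[ℂ] Fock K :=
    { toFun := fun ψ => ⟨fun n => T n (ψ (m n)), (memℓp_two_iff _).2
        (Summable.of_nonneg_of_le (fun n => by positivity) (hle ψ) (hsm ψ))⟩
      map_add' := fun a b => by
        apply Subtype.ext
        funext n
        exact map_add (T n) _ _
      map_smul' := fun c a => by
        apply Subtype.ext
        funext n
        exact map_smul (T n) _ _ }
  have hL₀ : ∀ ψ, ‖L₀ ψ‖ ≤ C * ‖ψ‖ := by
    intro ψ
    refine (sq_le_sq₀ (norm_nonneg _) (by positivity)).1 ?_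
    rw [← (hs (L₀ ψ)).tsum_eq, mul_pow, ← (hs ψ).tsum_eq, ← tsum_mul_left]
    refine ((hs (L₀ ψ)).summable.tsum_le_tsum (hle ψ) (hsm ψ)).trans ?_
    exact (hsm ψ).tsum_le_tsum_of_inj m hm (fun n _ => by positivity) (fun n => le_rfl)
      ((hs ψ).summable.mul_left _)
  exact ⟨L₀.mkContinuous C hL₀, L₀.mkContinuous_norm_le hC0 hL₀, fun ψ n => rfl⟩

theorem smul_expVec_apply (t : ℂ) (g : K) (n : ℕ) : t ^ n • expVec g n = expVec (t • g) n := by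
  show t ^ n • ((((Real.sqrt n.factorial)⁻¹ : ℝ) : ℂ) • symPow g n) =
    (((Real.sqrt n.factorial)⁻¹ : ℝ) : ℂ) • symPow (t • g) n
  rw [symPow_smul, smul_comm]

/-- The second quantization `Γ(t)` of multiplication by `t`. -/
theorem exists_secondQuantization {t : ℝ} (h0 : 0 ≤ t) (h1 : t ≤ 1) :
    ∃ L : Fock K →L[ℂ] Fock K, ‖L‖ ≤ 1 ∧ ∀ g, L (expVec g) = expVec ((t : ℂ) • g) := by
  obtain ⟨L, hL, hLa⟩ := exists_levelOp (K := K) (m := fun n => n) Function.injective_id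
    (fun n => (t : ℂ) ^ n • ContinuousLinearMap.id ℂ (Sym K n)) (C := 1) (fun n => by
      rw [norm_smul, norm_pow, Complex.norm_real, Real.norm_eq_abs, abs_of_nonneg h0]
      exact mul_le_one₀ (pow_le_one₀ h0 h1) (norm_nonneg _) ContinuousLinearMap.norm_id_le)
  refine ⟨L, hL, fun g => ?_⟩
  apply Subtype.ext
  funext n
  exact (hLa _ _).trans (smul_expVec_apply _ _ _)

theorem sqrt_mul_pow_le {t : ℝ} (h0 : 0 ≤ t) (h1 : t < 1) (n : ℕ) :
    t ^ n * √(n + 1) ≤ 1 / √(1 - t) := by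
  have h2 : 0 < 1 - t := by linarith
  have h3 : ((n : ℝ) + 1) * t ^ n ≤ ∑ k ∈ Finset.range (n + 1), t ^ k := by
    have := Finset.card_nsmul_le_sum (Finset.range (n + 1)) (fun k => t ^ k) (t ^ n) fun k hk =>
      pow_le_pow_of_le_one h0 h1.le (Nat.lt_succ_iff.1 (Finset.mem_range.1 hk))
    simpa using this
  have h4 : (∑ k ∈ Finset.range (n + 1), t ^ k) * (1 - t) = 1 - t ^ (n + 1) := by
    have := geom_sum_mul t (n + 1)
    linarith
  have h5 : ((n : ℝ) + 1) * t ^ n * (1 - t) ≤ 1 := by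
    have h6 := mul_le_mul_of_nonneg_right h3 h2.le
    have h7 : 0 ≤ t ^ (n + 1) := by positivity
    linarith
  rw [le_div_iff₀ (Real.sqrt_pos.2 h2), mul_assoc, ← Real.sqrt_mul (by positivity)]
  refine (sq_le_sq₀ (by positivity) zero_le_one).1 ?_
  rw [mul_pow, Real.sq_sqrt (by positivity), one_pow]
  calc (t ^ n) ^ 2 * (((n : ℝ) + 1) * (1 - t))
      = t ^ n * (((n : ℝ) + 1) * t ^ n * (1 - t)) := by ring
    _ ≤ 1 * 1 := mul_le_mul (pow_le_one₀ h0 h1.le) h5 (by positivity) zero_le_one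
    _ = 1 := one_mul 1

/-- The regularized annihilation operator `Γ(t) a(x)`; the number operator costs a factor
`(1 - t)^(-1/2)`. -/
theorem exists_regularized_annihilation (x : K) {t : ℝ} (h0 : 0 ≤ t) (h1 : t < 1) :
    ∃ L : Fock K →L[ℂ] Fock K, ‖L‖ ≤ ‖x‖ / √(1 - t) ∧
      ∀ g, L (expVec g) = (inner ℂ x g : ℂ) • expVec ((t : ℂ) • g) := by
  obtain ⟨L, hL, hLa⟩ := exists_levelOp (K := K) (m := fun n => n + 1) (add_left_injective 1)
    (fun n => (t : ℂ) ^ n • annLevel x n) (C := ‖x‖ / √(1 - t)) (fun n => by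
      rw [norm_smul, norm_pow, Complex.norm_real, Real.norm_eq_abs, abs_of_nonneg h0, annLevel,
        LinearIsometryEquiv.norm_map]
      refine (mul_le_mul_of_nonneg_left (norm_creLevel_le x n) (by positivity)).trans ?_
      rw [← mul_assoc, div_eq_mul_one_div, mul_comm ‖x‖]
      exact mul_le_mul_of_nonneg_right (sqrt_mul_pow_le h0 h1 n) (norm_nonneg _))
  refine ⟨L, hL, fun g => ?_⟩
  apply Subtype.ext
  funext n
  refine (hLa _ _).trans ?_
  have h2 := congrFun (annSeq_expVec x g) n
  have h3 : annLevel x n (expVec g (n + 1)) = (inner ℂ x g : ℂ) • expVec g n := h2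
  rw [smul_apply, h3, smul_comm, smul_expVec_apply]
  rfl

end Regularization

section Field

variable {E : Type u} [NormedAddCommGroup E] [InnerProductSpace ℝ E]

/-- The vector `x` in the decomposition `Q(k₁) - P(k₂) = a(x) + a⁺(y)`. -/
def annVec (k : Cplx E × Cplx E) : Cplx E := k.1.conj + Complex.I • k.2.conj

/-- The vector `y` in the decomposition `Q(k₁) - P(k₂) = a(x) + a⁺(y)`. -/
def creVec (k : Cplx E × Cplx E) : Cplx E := k.1 + Complex.I • k.2

/-- The pair `(k̄₁, k̄₂)`, whose field operator is the formal adjoint of that of `k`. -/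
def conjPair (k : Cplx E × Cplx E) : Cplx E × Cplx E := (k.1.conj, k.2.conj)

theorem conj_conj (z : Cplx E) : z.conj.conj = z := Cplx.ext' rfl (neg_neg _)

theorem annVec_conjPair (k : Cplx E × Cplx E) : annVec (conjPair k) = creVec k := by
  simp only [annVec, creVec, conjPair, conj_conj]

theorem creVec_conjPair (k : Cplx E × Cplx E) : creVec (conjPair k) = annVec k := rfl

theorem inner_expVec_fieldExp (k : Cplx E × Cplx E) (f g : Cplx E) :
    inner ℂ (expVec f) (fieldExp k g) =
      (inner ℂ (annVec k) g + inner ℂ f (creVec k)) * Complex.exp (inner ℂ f g) := by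
  have hP : momentumExp k.2 g = Complex.I •
      (annihilation k.2.conj ⟨expVec g, expVec_mem_annihilation _ g⟩ -
        creation k.2 ⟨expVec g, expVec_mem_creation _ g⟩) := rfl
  have hQ : positionExp k.1 g =
      annihilation k.1.conj ⟨expVec g, expVec_mem_annihilation _ g⟩ +
        creation k.1 ⟨expVec g, expVec_mem_creation _ g⟩ := rfl
  rw [fieldExp, hP, hQ, annihilation_expVec, annihilation_expVec]
  simp only [inner_add_right, inner_sub_right, inner_smul_right, inner_expVec_creation,
    inner_expVec, annVec, creVec, inner_add_left, inner_smul_left, Complex.conj_I]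
  ring

theorem inner_fieldExp_expVec (k : Cplx E × Cplx E) (f g : Cplx E) :
    inner ℂ (fieldExp (conjPair k) f) (expVec g) =
      (inner ℂ (annVec k) g + inner ℂ f (creVec k)) * Complex.exp (inner ℂ f g) := by
  rw [← inner_conj_symm, inner_expVec_fieldExp, annVec_conjPair, creVec_conjPair, map_mul, map_add,
    ← Complex.exp_conj, inner_conj_symm, inner_conj_symm, inner_conj_symm, add_comm]

/-- Regularized field operators `G = F Γ(r)`, `G' = F' Γ(r)`, where `F = Q(k₁) - P(k₂)` and `F'` is
its formal adjoint; the commutator `Γ(r)² F - F Γ(r)²` is small as `r → 1`, because it equals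
`(1 - r²)` times `Γ(r²) a(x) - a⁺(y) Γ(r²)`. -/
theorem exists_regularized_field (k : Cplx E × Cplx E) {r : ℝ} (h0 : 0 < r) (h1 : r < 1) :
    ∃ S G G' : BddOp E, ‖S‖ ≤ 1 ∧ (∀ g, S (expVec g) = expVec ((r : ℂ) • g)) ∧
      (∀ x y, inner ℂ x (S y) = inner ℂ (S x) y) ∧
      (∀ g, G (expVec g) = fieldExp k ((r : ℂ) • g)) ∧
      (∀ g, G' (expVec g) = fieldExp (conjPair k) ((r : ℂ) • g)) ∧
      ‖S * ContinuousLinearMap.adjoint G' - G * S‖ ≤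
        √(1 - r ^ 2) * (‖annVec k‖ + ‖creVec k‖) := by
  obtain ⟨S, hS, hSe⟩ := exists_secondQuantization (K := Cplx E) h0.le h1.le
  have hfield : ∀ k : Cplx E × Cplx E, ∃ G : BddOp E, ∀ g,
      G (expVec g) = fieldExp k ((r : ℂ) • g) := by
    intro k
    obtain ⟨A, -, hA⟩ := exists_regularized_annihilation (annVec k) h0.le h1
    obtain ⟨B, -, hB⟩ := exists_regularized_annihilation (creVec k) h0.le h1
    -- `a(x) Γ(r) = r Γ(r) a(x)` and `a⁺(y) Γ(r) = (Γ(r) a(y))*`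
    refine ⟨(r : ℂ) • A + ContinuousLinearMap.adjoint B, fun g => ext_inner_expVec fun f => ?_⟩
    rw [add_apply, inner_add_right, ContinuousLinearMap.adjoint_inner_right, smul_apply, hA, hB,
      inner_smul_right, inner_smul_right, inner_smul_left, inner_expVec, inner_expVec,
      inner_expVec_fieldExp, inner_conj_symm, inner_smul_left, inner_smul_right, inner_smul_right,
      Complex.conj_ofReal]
    ring
  obtain ⟨G, hG⟩ := hfield k
  obtain ⟨G', hG'⟩ := hfield (conjPair k)
  have hadj : ContinuousLinearMap.adjoint S = S := ext_expVec₂ fun f g => by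
    rw [ContinuousLinearMap.adjoint_inner_right, hSe, hSe, inner_expVec, inner_expVec,
      inner_smul_left, inner_smul_right, Complex.conj_ofReal]
  have hsym : ∀ x y, inner ℂ x (S y) = inner ℂ (S x) y := fun x y => by
    rw [← ContinuousLinearMap.adjoint_inner_right, hadj]
  refine ⟨S, G, G', hS, hSe, hsym, hG, hG', ?_⟩
  have h2 : r ^ 2 < 1 := by nlinarith
  have h3 : 0 < 1 - r ^ 2 := by linarith
  obtain ⟨A, hAn, hA⟩ := exists_regularized_annihilation (annVec k) (sq_nonneg r) h2
  obtain ⟨B, hBn, hB⟩ := exists_regularized_annihilation (creVec k) (sq_nonneg r) h2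
  have key : S * ContinuousLinearMap.adjoint G' - G * S =
      ((1 - r ^ 2 : ℝ) : ℂ) • (A - ContinuousLinearMap.adjoint B) := by
    refine ext_expVec₂ fun f g => ?_
    rw [sub_apply, mul_apply_eq_comp, mul_apply_eq_comp, inner_sub_right, hsym, hSe,
      ContinuousLinearMap.adjoint_inner_right, hG', hSe, hG, inner_fieldExp_expVec,
      inner_expVec_fieldExp, smul_apply, sub_apply]
    simp only [inner_smul_right, inner_sub_right, ContinuousLinearMap.adjoint_inner_right, hA, hB,
      inner_smul_left, inner_expVec, inner_conj_symm, Complex.conj_ofReal]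
    push_cast
    have h4 : (r : ℂ) * (r * inner ℂ f g) = (r : ℂ) ^ 2 * inner ℂ f g := by ring
    rw [h4]
    ring
  rw [key, norm_smul, Complex.norm_real, Real.norm_eq_abs, abs_of_pos h3]
  have h4 : ‖A - ContinuousLinearMap.adjoint B‖ ≤ (‖annVec k‖ + ‖creVec k‖) / √(1 - r ^ 2) := by
    refine (norm_sub_le _ _).trans ?_
    rw [LinearIsometryEquiv.norm_map, add_div]
    exact add_le_add hAn hBn
  refine (mul_le_mul_of_nonneg_left h4 h3.le).trans (le_of_eq ?_)
  have h5 := Real.sqrt_pos.2 h3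
  field_simp
  rw [Real.sq_sqrt h3.le]
  ring

/-- The linear form `u ⟨h₁, k₁⟩ + v ⟨h₂, k₂⟩`; `D_k` multiplies characteristic functions by `-i` times
it. -/
noncomputable def symbol (h : E × E) (k : Cplx E × Cplx E) (q : ℝ × ℝ) : ℂ :=
  q.1 * inner ℂ (Cplx.ofReal h.1) k.1 + q.2 * inner ℂ (Cplx.ofReal h.2) k.2

theorem inner_annVec_add_inner_creVec (h : E × E) (k : Cplx E × Cplx E) (q : ℝ × ℝ) :
    inner ℂ (annVec k) (displacement h q) + inner ℂ (displacement h q) (creVec k) =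
      2 * symbol h k q := by
  simp only [symbol, Cplx.inner_def]
  apply Complex.ext
  · simp [displacement, annVec, creVec, Cplx.conj, Cplx.ofReal, real_inner_smul_left,
      inner_add_left, inner_add_right, real_inner_comm]
    ring
  · simp [displacement, annVec, creVec, Cplx.conj, Cplx.ofReal, real_inner_smul_left,
      inner_add_left, inner_add_right, real_inner_comm]
    ring

/-- Weyl operators shift the field operators: `(Q(k₁) - P(k₂)) U(q) = U(q) (Q(k₁) - P(k₂) + 2 s)` with
`s = symbol h k q`, on exponential vectors. -/
theorem smul_fieldExp_add (h : E × E) (k : Cplx E × Cplx E) (q : ℝ × ℝ) (g : Cplx E) :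
    Complex.exp (-inner ℂ (displacement h q) g - (‖displacement h q‖ : ℂ) ^ 2 / 2) •
        fieldExp k (g + displacement h q) =
      weylFamily h q (fieldExp k g) + (2 * symbol h k q) • weylFamily h q (expVec g) := by
  refine ext_inner_expVec fun f => ?_
  have h1 : inner ℂ (expVec f) (weylFamily h q (fieldExp k g)) =
      inner ℂ (weylFamily h (-q) (expVec f)) (fieldExp k g) := by
    rw [(isWeylSystem_weylFamily h).inner_apply_left, neg_neg]
  rw [inner_add_right, h1, inner_smul_right, inner_smul_right, weylFamily_expVec, weylFamily_expVec,
    weylExp, weylExp, inner_smul_left, inner_smul_right, inner_expVec_fieldExp,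
    inner_expVec_fieldExp, inner_expVec, displacement_neg, ← Complex.exp_conj, norm_neg,
    ← inner_annVec_add_inner_creVec]
  set z := displacement h q
  have h2 : Complex.exp ((starRingEnd ℂ) (-inner ℂ (-z) f - (‖z‖ : ℂ) ^ 2 / 2)) *
      Complex.exp (inner ℂ (f + -z) g) =
      Complex.exp (-inner ℂ z g - (‖z‖ : ℂ) ^ 2 / 2) * Complex.exp (inner ℂ f (g + z)) := by
    rw [← Complex.exp_add, ← Complex.exp_add]
    congr 1
    simp only [map_sub, map_neg, map_div₀, map_pow, Complex.conj_ofReal, map_ofNat,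
      inner_conj_symm, inner_add_left, inner_add_right, inner_neg_left]
    ring
  rw [mul_left_comm _ (inner ℂ (annVec k) g + _), h2]
  simp only [inner_add_left, inner_add_right, inner_neg_left]
  ring

end Field

/-! ### The characteristic function of a derivative -/

section Derivative

variable {E : Type u} [NormedAddCommGroup E] [InnerProductSpace ℝ E]

/-- The commutator identity defining `D_k B = M`, smoothed by `Γ(r)` on both sides and multiplied by
a Weyl operator. All factors are bounded. -/
theorem regularized_commutator (h : E × E) {k : Cplx E × Cplx E} {B M : BddOp E}
    (hD : IsFrechetDeriv k B M) (q : ℝ × ℝ) {r : ℂ} {S G G' : BddOp E}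
    (hS : ∀ g, S (expVec g) = expVec (r • g)) (hsym : ∀ x y, inner ℂ x (S y) = inner ℂ (S x) y)
    (hG : ∀ g, G (expVec g) = fieldExp k (r • g))
    (hG' : ∀ g, G' (expVec g) = fieldExp (conjPair k) (r • g)) :
    S * M * (weylFamily h q * S) =
      (Complex.I / 2) • (ContinuousLinearMap.adjoint G' * B * (weylFamily h q * S) -
        S * B * (weylFamily h q * G)) -
      (Complex.I * symbol h k q) • (S * B * (weylFamily h q * S)) := by
  refine ext_expVec₂ fun f g => ?_
  have h1 := smul_fieldExp_add h k q (r • g)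
  have h2 := hD (r • f) (r • g + displacement h q)
  set γ := Complex.exp (-inner ℂ (displacement h q) (r • g) - (‖displacement h q‖ : ℂ) ^ 2 / 2)
    with hγ
  have h3 : weylFamily h q (expVec (r • g)) = γ • expVec (r • g + displacement h q) :=
    weylFamily_expVec h q _
  have h4 : weylFamily h q (fieldExp k (r • g)) = γ • fieldExp k (r • g + displacement h q) -
      (2 * symbol h k q) • γ • expVec (r • g + displacement h q) := by
    rw [← h3]
    exact eq_sub_of_add_eq h1.symm
  have h5 : fieldExp (k.1.conj, k.2.conj) (r • f) = fieldExp (conjPair k) (r • f) := rfl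
  rw [h5] at h2
  simp only [sub_apply, smul_apply, mul_apply_eq_comp, hS, hG, inner_sub_right, inner_smul_right,
    hsym, ContinuousLinearMap.adjoint_inner_right, hG', h3, h4, map_sub, map_smul, h2]
  ring

theorem trace_eq_of_hasSum {H : Type*} [NormedAddCommGroup H] [InnerProductSpace ℂ H]
    [CompleteSpace H] {T : H →L[ℂ] H} {t : ℂ}
    (h : HasSum (fun j => inner ℂ (hilbertBasis H j) (T (hilbertBasis H j))) t) : trace T = t :=
  h.tsum_eq

/-- Traces of the smoothed commutator identity: by cyclicity what is left of the commutator with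
`F` is the commutator of `F` with `Γ(r)²`. -/
theorem trace_regularized_commutator (h : E × E) {k : Cplx E × Cplx E} {B M : BddOp E}
    (hD : IsFrechetDeriv k B M) {ι ι' : Type*} {ξ ψ : ι → Fock (Cplx E)} {ξ' ψ' : ι' → Fock (Cplx E)}
    (hB : IsNuclear B ξ ψ) (hM : IsNuclear M ξ' ψ') (q : ℝ × ℝ) {r : ℂ} {S G G' : BddOp E}
    (hS : ∀ g, S (expVec g) = expVec (r • g)) (hsym : ∀ x y, inner ℂ x (S y) = inner ℂ (S x) y)
    (hG : ∀ g, G (expVec g) = fieldExp k (r • g))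
    (hG' : ∀ g, G' (expVec g) = fieldExp (conjPair k) (r • g)) :
    trace (M * (weylFamily h q * S * S)) + Complex.I * symbol h k q *
        trace (B * (weylFamily h q * S * S)) =
      Complex.I / 2 * trace (B * (weylFamily h q *
        (S * ContinuousLinearMap.adjoint G' - G * S))) := by
  set U := weylFamily h q
  have h1 := (((((hB.mul_left (ContinuousLinearMap.adjoint G')).hasSum_trace (U * S)).sub
    ((hB.mul_left S).hasSum_trace (U * G))).mul_left (Complex.I / 2)).sub
    (((hB.mul_left S).hasSum_trace (U * S)).mul_left (Complex.I * symbol h k q)))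
  have h2 : trace (S * M * (U * S)) = Complex.I / 2 *
      (trace (ContinuousLinearMap.adjoint G' * B * (U * S)) - trace (S * B * (U * G))) -
      Complex.I * symbol h k q * trace (S * B * (U * S)) := by
    rw [regularized_commutator h hD q hS hsym hG hG']
    refine trace_eq_of_hasSum (h1.congr_fun fun j => ?_)
    simp only [sub_apply, smul_apply, inner_sub_right, inner_smul_right, U]
  have h3 : trace (B * (U * (S * ContinuousLinearMap.adjoint G' - G * S))) =
      trace (B * (U * S * ContinuousLinearMap.adjoint G')) - trace (B * (U * G * S)) := by
    refine trace_eq_of_hasSum (((hB.hasSum_trace _).sub (hB.hasSum_trace _)).congr_fun fun j => ?_)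
    simp only [mul_apply_eq_comp, sub_apply, map_sub, inner_sub_right]
  rw [hM.trace_mul_cycle, hB.trace_mul_cycle, hB.trace_mul_cycle, hB.trace_mul_cycle] at h2
  rw [h3]
  linear_combination h2

/-- On characteristic functions the derivation `D_k` is multiplication by `-i` times a linear
form. -/
theorem charFn_of_isFrechetDeriv (h : E × E) {k : Cplx E × Cplx E} {B M : BddOp E}
    (hD : IsFrechetDeriv k B M) {ι ι' : Type*} {ξ ψ : ι → Fock (Cplx E)} {ξ' ψ' : ι' → Fock (Cplx E)}
    (hB : IsNuclear B ξ ψ) (hM : IsNuclear M ξ' ψ') (q : ℝ × ℝ) :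
    charFn (weylFamily h) M q = -Complex.I * symbol h k q * charFn (weylFamily h) B q := by
  have hU := isWeylSystem_weylFamily h
  let r : ℕ → ℝ := fun n => 1 - 1 / ((n : ℝ) + 2)
  have hlim0 : Filter.Tendsto (fun n : ℕ => 1 / ((n : ℝ) + 2)) Filter.atTop (nhds 0) := by
    have := (tendsto_one_div_add_atTop_nhds_zero_nat (𝕜 := ℝ)).comp (Filter.tendsto_add_atTop_nat 1)
    refine this.congr fun n => ?_
    simp only [Function.comp_apply]
    push_cast
    ring
  have hlim : Filter.Tendsto r Filter.atTop (nhds 1) := by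
    simpa [r] using hlim0.const_sub 1
  have hr0 : ∀ n, 0 < r n := fun n => by
    have : 1 / ((n : ℝ) + 2) < 1 := by rw [div_lt_one (by positivity)]; linarith
    simp only [r]; linarith
  have hr1 : ∀ n, r n < 1 := fun n => by
    have : 0 < 1 / ((n : ℝ) + 2) := by positivity
    simp only [r]; linarith
  choose S G G' hSn hS hsym hG hG' hR using fun n => exists_regularized_field k (hr0 n) (hr1 n)
  have hT : ∀ n, ‖weylFamily h q * S n * S n‖ ≤ 1 := fun n => by
    have h1 := norm_mul_le (weylFamily h q * S n) (S n)
    have h2 := norm_mul_le (weylFamily h q) (S n)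
    have h3 := hU.norm_le_one q
    have h4 : ‖weylFamily h q‖ * ‖S n‖ ≤ 1 := mul_le_one₀ h3 (norm_nonneg _) (hSn n)
    exact h1.trans (mul_le_one₀ (h2.trans h4) (norm_nonneg _) (hSn n))
  have hTs : ∀ x, Filter.Tendsto (fun n => (weylFamily h q * S n * S n) x) Filter.atTop
      (nhds (weylFamily h q x)) := by
    refine tendsto_of_tendsto_expVec hT fun f => ?_
    have h1 : ∀ n, (weylFamily h q * S n * S n) (expVec f) =
        weylFamily h q (expVec ((r n : ℂ) • (r n : ℂ) • f)) := fun n => by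
      rw [mul_apply_eq_comp, mul_apply_eq_comp, hS, hS]
    simp only [h1]
    have h2 : Continuous fun t : ℝ => weylFamily h q (expVec ((t : ℂ) • (t : ℂ) • f)) := by
      have := continuous_expVec (K := Cplx E)
      fun_prop
    have h3 := (h2.tendsto 1).comp hlim
    simpa [Function.comp_def] using h3
  have hleft := ((hM.tendsto_trace (Filter.Eventually.of_forall hT) hTs).add
    ((hB.tendsto_trace (Filter.Eventually.of_forall hT) hTs).const_mul
      (Complex.I * symbol h k q)))
  have hright : Filter.Tendsto (fun n => Complex.I / 2 * trace (B * (weylFamily h q *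
      (S n * ContinuousLinearMap.adjoint (G' n) - G n * S n)))) Filter.atTop (nhds 0) := by
    have hz : Filter.Tendsto (fun n => √(1 - r n ^ 2) * (‖annVec k‖ + ‖creVec k‖)) Filter.atTop
        (nhds 0) := by
      have h2 : Continuous fun t : ℝ => √(1 - t ^ 2) * (‖annVec k‖ + ‖creVec k‖) := by fun_prop
      have h3 := (h2.tendsto 1).comp hlim
      simpa [Function.comp_def] using h3
    have hz2 := (hz.const_mul (∑' i, ‖ξ i‖ * ‖ψ i‖))
    rw [mul_zero] at hz2
    have h4 : Filter.Tendsto (fun n => trace (B * (weylFamily h q *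
        (S n * ContinuousLinearMap.adjoint (G' n) - G n * S n)))) Filter.atTop (nhds 0) := by
      refine squeeze_zero_norm (fun n => ?_) hz2
      refine (hB.norm_trace_le _).trans (mul_le_mul_of_nonneg_left ?_
        (tsum_nonneg fun i => by positivity))
      refine (norm_mul_le _ _).trans ?_
      exact (mul_le_of_le_one_left (norm_nonneg _) (hU.norm_le_one q)).trans (hR n)
    simpa using h4.const_mul (Complex.I / 2)
  have heq := tendsto_nhds_unique hleft (hright.congr fun n =>
    (trace_regularized_commutator h hD hB hM q (hS n) (hsym n) (hG n) (hG' n)).symm)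
  simp only [charFn]
  linear_combination heq

end Derivative

/-! ### Densities of polynomially weighted characteristic functions -/

section Density

/-- `χ` has a square integrable, essentially bounded Fourier transform. -/
def HasBoundedDensity (χ : ℝ × ℝ → ℂ) : Prop :=
  (∀ φ : 𝓢(ℝ × ℝ, ℂ), Integrable fun q => χ q * invFourier φ q) ∧
    ∃ w, MemLp w 2 ∧ (∃ C, ∀ᵐ p, ‖w p‖ ≤ C) ∧ IsFourierDensity χ w

theorem schwartz_mul_integrable (φ : 𝓢(ℝ × ℝ, ℂ)) {w : ℝ × ℝ → ℂ} (hw : MemLp w 2) :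
    Integrable fun p => φ p * w p :=
  (φ.memLp 2).integrable_mul hw

theorem HasBoundedDensity.const_mul {χ : ℝ × ℝ → ℂ} (h : HasBoundedDensity χ) (c : ℂ) :
    HasBoundedDensity fun q => c * χ q := by
  obtain ⟨hi, w, hw, ⟨C, hC⟩, hd⟩ := h
  refine ⟨fun φ => ?_, fun p => c * w p, hw.const_mul c, ⟨‖c‖ * C, ?_⟩, fun φ => ?_⟩
  · simpa only [mul_assoc] using (hi φ).const_mul c
  · filter_upwards [hC] with p hp
    rw [norm_mul]
    exact mul_le_mul_of_nonneg_left hp (norm_nonneg _)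
  · simp only [mul_left_comm _ c, mul_assoc c, integral_const_mul, hd φ]

theorem HasBoundedDensity.add {χ χ' : ℝ × ℝ → ℂ} (h : HasBoundedDensity χ)
    (h' : HasBoundedDensity χ') : HasBoundedDensity fun q => χ q + χ' q := by
  obtain ⟨hi, w, hw, ⟨C, hC⟩, hd⟩ := h
  obtain ⟨hi', w', hw', ⟨C', hC'⟩, hd'⟩ := h'
  refine ⟨fun φ => ?_, fun p => w p + w' p, hw.add hw', ⟨C + C', ?_⟩, fun φ => ?_⟩
  · exact ((hi φ).add (hi' φ)).congr (Filter.Eventually.of_forall fun q => (add_mul _ _ _).symm)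
  · filter_upwards [hC, hC'] with p hp hp'
    exact (norm_add_le _ _).trans (add_le_add hp hp')
  · simp only [add_mul, mul_add]
    rw [integral_add (schwartz_mul_integrable φ hw) (schwartz_mul_integrable φ hw'),
      integral_add (hi φ) (hi' φ), hd φ, hd' φ, mul_add]

variable {E : Type u} [NormedAddCommGroup E] [InnerProductSpace ℝ E]

theorem hasBoundedDensity_charFn {h : E × E} (hh : inner ℝ h.1 h.2 ≠ 0) {A : BddOp E}
    (hA : traceAbs A < ⊤) : HasBoundedDensity (charFn (weylFamily h) A) := by
  obtain ⟨ι, _, ξ, ψ, hN⟩ := exists_isNuclear hA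
  have hU := isWeylSystem_weylFamily h
  have hc := hU.continuous_charFn hN
  obtain ⟨w, hw, hd⟩ := exists_memLp_two_isFourierDensity hc (hU.memLp_charFn hN hh)
  refine ⟨fun φ => ?_, w, hw, hd.ae_norm_le (hw.locallyIntegrable (by norm_num)) hc
    (hU.norm_charFn_le hN) fun ε hε p => hU.norm_integral_gauss_mul_charFn_le hN hh p hε, hd⟩
  exact ((integrable_invFourier φ).mul_bdd hc.aestronglyMeasurable
    (Filter.Eventually.of_forall (hU.norm_charFn_le hN))).congr
    (Filter.Eventually.of_forall fun q => mul_comm _ _)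

theorem IsFrechetDeriv.unique {k : Cplx E × Cplx E} {B M M' : BddOp E} (h : IsFrechetDeriv k B M)
    (h' : IsFrechetDeriv k B M') : M = M' :=
  ext_expVec₂ fun f g => (h f g).trans (h' f g).symm

theorem IsIterFrechetDeriv.unique {k : Cplx E × Cplx E} {n : ℕ} {B M M' : BddOp E}
    (h : IsIterFrechetDeriv k n B M) (h' : IsIterFrechetDeriv k n B M') : M = M' := by
  induction n generalizing M M' with
  | zero => exact Eq.trans h (Eq.symm h')
  | succ n ih =>
    obtain ⟨N, hN, hM⟩ := h
    obtain ⟨N', hN', hM'⟩ := h'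
    rw [← ih hN hN'] at hM'
    exact hM.unique hM'

theorem charFn_of_isIterFrechetDeriv (h : E × E) {k : Cplx E × Cplx E} {B : BddOp E} {N : ℕ}
    (htr : ∀ n ≤ N, ∀ A, IsIterFrechetDeriv k n B A → traceAbs A < ⊤) {n : ℕ} (hn : n ≤ N)
    {A : BddOp E} (hA : IsIterFrechetDeriv k n B A) (q : ℝ × ℝ) :
    charFn (weylFamily h) A q =
      (-Complex.I * symbol h k q) ^ n * charFn (weylFamily h) B q := by
  induction n generalizing A with
  | zero => rw [show A = B from hA, pow_zero, one_mul]
  | succ n ih =>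
    obtain ⟨_, _, _, _, hAn⟩ := exists_isNuclear (htr _ hn A hA)
    obtain ⟨M, hM, hMA⟩ := hA
    obtain ⟨_, _, _, _, hMn⟩ := exists_isNuclear (htr n (by omega) M hM)
    rw [charFn_of_isFrechetDeriv h hMA hMn hAn, ih (by omega) hM, pow_succ']
    ring

/-- The weighted characteristic functions given by the assumption on derivatives. -/
theorem hasBoundedDensity_symbol_pow {κ : ℕ} {h : E × E} (hh : inner ℝ h.1 h.2 ≠ 0) {ρ : BddOp E}
    {k ℓ : Cplx E × Cplx E}
    (hD : ∀ κ₁ κ₂ : ℕ, κ₁ + κ₂ ≤ κ → ∃ B A : BddOp E,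
      IsIterFrechetDeriv ℓ κ₂ ρ B ∧ IsIterFrechetDeriv k κ₁ B A ∧ traceAbs A < ⊤)
    {m n : ℕ} (hmn : m + n ≤ κ) :
    HasBoundedDensity fun q =>
      symbol h k q ^ m * (symbol h ℓ q ^ n * charFn (weylFamily h) ρ q) := by
  obtain ⟨B, A, hB, hA, hAt⟩ := hD m n hmn
  have h1 : ∀ n' ≤ κ, ∀ B', IsIterFrechetDeriv ℓ n' ρ B' → traceAbs B' < ⊤ := by
    intro n' hn' B' hB'
    obtain ⟨B'', A'', hB'', hA'', ht⟩ := hD 0 n' (by omega)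
    rw [hB'.unique hB'', ← show A'' = B'' from hA'']
    exact ht
  have h2 : ∀ m' ≤ m, ∀ A', IsIterFrechetDeriv k m' B A' → traceAbs A' < ⊤ := by
    intro m' hm' A' hA'
    obtain ⟨B'', A'', hB'', hA'', ht⟩ := hD m' n (by omega)
    rw [hB''.unique hB] at hA''
    rw [hA'.unique hA'']
    exact ht
  have h3 : (fun q => symbol h k q ^ m * (symbol h ℓ q ^ n * charFn (weylFamily h) ρ q)) =
      fun q => Complex.I ^ (m + n) * charFn (weylFamily h) A q := by
    funext q
    rw [charFn_of_isIterFrechetDeriv h h2 le_rfl hA q,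
      charFn_of_isIterFrechetDeriv h h1 (by omega : n ≤ κ) hB q, mul_pow, mul_pow, pow_add]
    have h4 : ∀ j : ℕ, Complex.I ^ j * (-Complex.I) ^ j = 1 := fun j => by
      rw [← mul_pow, mul_neg, Complex.I_mul_I, neg_neg, one_pow]
    linear_combination (-(symbol h k q ^ m * (symbol h ℓ q ^ n * charFn (weylFamily h) ρ q))) *
      (h4 m * (Complex.I ^ n * (-Complex.I) ^ n) + h4 n)
  rw [h3]
  exact (hasBoundedDensity_charFn hh hAt).const_mul _

/-- By Cramer's rule the coordinates `u`, `v` are linear combinations of the symbols of `D_k` and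
`D_ℓ`, so monomial weights can be traded for products of symbols. -/
theorem hasBoundedDensity_coord_pow {κ : ℕ} {h : E × E} {k ℓ : Cplx E × Cplx E}
    (hdet : Matrix.det !![inner ℂ (Cplx.ofReal h.1) k.1, inner ℂ (Cplx.ofReal h.2) k.2;
      inner ℂ (Cplx.ofReal h.1) ℓ.1, inner ℂ (Cplx.ofReal h.2) ℓ.2] ≠ 0) {χ : ℝ × ℝ → ℂ}
    (hχ : ∀ m n : ℕ, m + n ≤ κ →
      HasBoundedDensity fun q => symbol h k q ^ m * (symbol h ℓ q ^ n * χ q))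
    (a b : ℕ) : ∀ m n : ℕ, a + b + m + n ≤ κ → HasBoundedDensity fun q =>
      (q.1 : ℂ) ^ a * ((q.2 : ℂ) ^ b * (symbol h k q ^ m * (symbol h ℓ q ^ n * χ q))) := by
  rw [Matrix.det_fin_two_of] at hdet
  set D := inner ℂ (Cplx.ofReal h.1) k.1 * inner ℂ (Cplx.ofReal h.2) ℓ.2 -
    inner ℂ (Cplx.ofReal h.2) k.2 * inner ℂ (Cplx.ofReal h.1) ℓ.1 with hDdef
  induction a with
  | zero =>
    induction b with
    | zero =>
      intro m n hmn
      simpa only [pow_zero, one_mul] using hχ m n (by omega)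
    | succ b ih =>
      intro m n hmn
      have h1 := ((ih m (n + 1) (by omega)).const_mul (inner ℂ (Cplx.ofReal h.1) k.1 / D)).add
        ((ih (m + 1) n (by omega)).const_mul (-inner ℂ (Cplx.ofReal h.1) ℓ.1 / D))
      refine (congrArg HasBoundedDensity (funext fun q => ?_)).mp h1
      have h2 : (q.2 : ℂ) = inner ℂ (Cplx.ofReal h.1) k.1 / D * symbol h ℓ q +
          -inner ℂ (Cplx.ofReal h.1) ℓ.1 / D * symbol h k q := by
        field_simp
        rw [hDdef]
        simp only [symbol]
        ring
      rw [pow_succ (q.2 : ℂ) b]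
      conv_rhs => rw [show ∀ x : ℂ, (q.2 : ℂ) ^ b * (q.2 : ℂ) * x = (q.2 : ℂ) * ((q.2 : ℂ) ^ b * x)
        from fun x => by ring]
      linear_combination (-((q.2 : ℂ) ^ b * (symbol h k q ^ m * (symbol h ℓ q ^ n * χ q)))) * h2
  | succ a ih =>
    intro m n hmn
    have h1 := ((ih (m + 1) n (by omega)).const_mul (inner ℂ (Cplx.ofReal h.2) ℓ.2 / D)).add
      ((ih m (n + 1) (by omega)).const_mul (-inner ℂ (Cplx.ofReal h.2) k.2 / D))
    refine (congrArg HasBoundedDensity (funext fun q => ?_)).mp h1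
    have h2 : (q.1 : ℂ) = inner ℂ (Cplx.ofReal h.2) ℓ.2 / D * symbol h k q +
        -inner ℂ (Cplx.ofReal h.2) k.2 / D * symbol h ℓ q := by
      field_simp
      rw [hDdef]
      simp only [symbol]
      ring
    linear_combination (-((q.1 : ℂ) ^ a * ((q.2 : ℂ) ^ b *
      (symbol h k q ^ m * (symbol h ℓ q ^ n * χ q))))) * h2

end Density

/-! ### Weyl quantization and characteristic functions -/

section Quantization

universe v

namespace IsWeylSystem

variable {H : Type v} [NormedAddCommGroup H] [InnerProductSpace ℂ H] [CompleteSpace H]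
  {c : ℝ} {U : ℝ × ℝ → H →L[ℂ] H}

/-- The strong integral `∫ f(q) U(q) dq` of a Weyl system. -/
theorem exists_integral (hU : IsWeylSystem c U) {f : ℝ × ℝ → ℂ} (hf : Integrable f) :
    ∃ M : H →L[ℂ] H, ∀ x y, inner ℂ x (M y) = ∫ q, f q * inner ℂ x (U q y) := by
  have hint : ∀ y, Integrable fun q => f q • U q y := fun y =>
    hf.smul_bdd _ (hU.continuous y).aestronglyMeasurable
      (Filter.Eventually.of_forall fun q => (hU.norm_apply q y).le)
  let L : H →ₗ[ℂ] H :=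
    { toFun := fun y => ∫ q, f q • U q y
      map_add' := fun y z => by
        rw [← integral_add (hint y) (hint z)]
        simp only [map_add, smul_add]
      map_smul' := fun a y => by
        rw [RingHom.id_apply, ← integral_smul]
        simp only [map_smul, smul_comm a] }
  refine ⟨L.mkContinuous (∫ q, ‖f q‖) fun y => ?_, fun x y => ?_⟩
  · rw [← integral_mul_const]
    refine norm_integral_le_of_norm_le (hf.norm.mul_const _) (Filter.Eventually.of_forall fun q => ?_)
    rw [norm_smul, hU.norm_apply]
  · refine (integral_inner (hint y) x).symm.trans ?_
    simp only [inner_smul_right]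

theorem trace_mul_integral {ι : Type v} [Countable ι] {A : H →L[ℂ] H} {ξ ψ : ι → H}
    (hU : IsWeylSystem c U) (hA : IsNuclear A ξ ψ) {f : ℝ × ℝ → ℂ} (hf : Integrable f)
    {M : H →L[ℂ] H} (hM : ∀ x y, inner ℂ x (M y) = ∫ q, f q * inner ℂ x (U q y)) :
    trace (A * M) = ∫ q, f q * charFn U A q := by
  refine (hA.hasSum_inner M).unique ?_
  simp only [hM]
  exact hU.hasSum_integral_charFn hA hf

/-- Characteristic functions of self-adjoint operators are Hermitian. -/
theorem charFn_neg {ι : Type v} {A : H →L[ℂ] H} {ξ ψ : ι → H} (hU : IsWeylSystem c U)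
    (hA : IsNuclear A ξ ψ) (hsa : IsSelfAdjoint A) (q : ℝ × ℝ) :
    charFn U A (-q) = starRingEnd ℂ (charFn U A q) := by
  have h1 := hA.adjoint
  rw [hsa.adjoint_eq] at h1
  refine (hasSum_charFn h1 (-q)).unique ((hasSum_charFn hA q).star.congr_fun fun i => ?_)
  rw [← hU.inner_apply_left, Complex.star_def, inner_conj_symm]

end IsWeylSystem

variable {E : Type v} [NormedAddCommGroup E] [InnerProductSpace ℝ E]

/-- `O_h(φ)` exists, and its expectation is the pairing of the characteristic function with `𝓕⁻¹ φ`. -/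
theorem exists_isWeylQuantization (h : E × E) (φ : 𝓢(ℝ × ℝ, ℂ)) :
    ∃ M, IsWeylQuantization h φ M ∧ ∀ {ι : Type v} [Countable ι] {A : BddOp E}
      {ξ ψ : ι → Fock (Cplx E)}, IsNuclear A ξ ψ → trace (A * M) =
        (1 / (2 * Real.pi) : ℝ) * ∫ q, charFn (weylFamily h) A q * invFourier φ q := by
  have hU := isWeylSystem_weylFamily h
  have hf := (integrable_invFourier φ).const_mul ((1 / (2 * Real.pi) : ℝ) : ℂ)
  obtain ⟨M, hM⟩ := hU.exists_integral hf
  refine ⟨M, fun f g => ?_, fun hA => ?_⟩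
  · rw [hM, ← integral_const_mul]
    congr 1; ext q
    rw [weylFamily]; ring
  · rw [hU.trace_mul_integral hA hf hM, ← integral_const_mul]
    congr 1; ext q
    ring

theorem IsWeylQuantization.unique {h : E × E} {φ : ℝ × ℝ → ℂ} {M M' : BddOp E}
    (hM : IsWeylQuantization h φ M) (hM' : IsWeylQuantization h φ M') : M = M' :=
  ext_expVec₂ fun f g => (hM f g).trans (hM' f g).symm

/-- Wigner densities are the real-valued Fourier transforms of the characteristic function. -/
theorem isWignerDensity_iff {h : E × E} {ρ : BddOp E} (hρ : traceAbs ρ < ⊤) {Φ : BddOp E → ℂ}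
    (hΦ : ∀ X, Φ X = trace (ρ * X)) (w : ℝ × ℝ → ℝ) :
    IsWignerDensity h Φ w ↔ (∀ φ : 𝓢(ℝ × ℝ, ℂ), Integrable fun p => φ p * (w p : ℂ)) ∧
      IsFourierDensity (charFn (weylFamily h) ρ) fun p => (w p : ℂ) := by
  obtain ⟨ι, _, ξ, ψ, hN⟩ := exists_isNuclear hρ
  refine ⟨fun hw => ⟨fun φ => ?_, fun φ => ?_⟩, fun hw φ => ?_⟩
  · obtain ⟨_, _, hi, _⟩ := hw φ
    exact hi
  · obtain ⟨M, hM, _, he⟩ := hw φ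
    obtain ⟨M', hM', ht⟩ := exists_isWeylQuantization h φ
    rw [he, hΦ, hM.unique hM', ht hN]
  · obtain ⟨M, hM, ht⟩ := exists_isWeylQuantization h φ
    exact ⟨M, hM, hw.1 φ, by rw [hw.2 φ, hΦ, ht hN]⟩

end Quantization

/-! ### Sobolev regularity of weak Fourier transforms -/

section Regularity

/-- A real test function as a complex Schwartz function. -/
noncomputable def testSchwartz {φ : ℝ × ℝ → ℝ} (hφ : ContDiff ℝ ((⊤ : ℕ∞) : WithTop ℕ∞) φ)
    (hc : HasCompactSupport φ) : 𝓢(ℝ × ℝ, ℂ) :=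
  (hc.comp_left (g := ((↑) : ℝ → ℂ)) Complex.ofReal_zero).toSchwartzMap
    (Complex.ofRealCLM.contDiff.comp hφ)

theorem coe_testSchwartz {φ : ℝ × ℝ → ℝ} (hφ : ContDiff ℝ ((⊤ : ℕ∞) : WithTop ℕ∞) φ)
    (hc : HasCompactSupport φ) : ⇑(testSchwartz hφ hc) = fun p => (φ p : ℂ) := rfl

theorem conj_invFourier (φ : ℝ × ℝ → ℝ) (q : ℝ × ℝ) :
    starRingEnd ℂ (invFourier (fun p => (φ p : ℂ)) q) = invFourier (fun p => (φ p : ℂ)) (-q) := by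
  rw [invFourier, invFourier, map_mul, Complex.conj_ofReal, ← integral_conj]
  congr 2; ext p
  rw [map_mul, Complex.conj_ofReal, ← Complex.exp_conj]
  congr 2
  simp only [map_neg, map_mul, Complex.conj_I, Complex.conj_ofReal, Prod.fst_neg, Prod.snd_neg]
  push_cast
  ring

/-- The Fourier transform of a Hermitian function is real. -/
theorem IsFourierDensity.ae_im_eq_zero {χ w : ℝ × ℝ → ℂ} (hw : IsFourierDensity χ w)
    (h2 : MemLp w 2) (hχ : ∀ q, χ (-q) = starRingEnd ℂ (χ q)) : ∀ᵐ p, (w p).im = 0 := by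
  refine ae_eq_zero_of_integral_contDiff_smul_eq_zero (h2.im.locallyIntegrable (by norm_num))
    fun φ hφ hc => ?_
  have h := hw (testSchwartz hφ hc)
  simp only [coe_testSchwartz] at h
  have hi := schwartz_mul_integrable (testSchwartz hφ hc) h2
  have hconj : starRingEnd ℂ (∫ q, χ q * invFourier (fun p => (φ p : ℂ)) q) =
      ∫ q, χ q * invFourier (fun p => (φ p : ℂ)) q := by
    rw [← integral_conj, ← integral_neg_eq_self (fun q => χ q * invFourier (fun p => (φ p : ℂ)) q)]
    congr 1; ext q
    rw [map_mul, conj_invFourier, hχ]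
  have him : (∫ p, (φ p : ℂ) * w p).im = 0 := by
    rw [← Complex.conj_eq_iff_im, h, map_mul, Complex.conj_ofReal, hconj]
  rw [← him]
  refine (integral_congr_ae (Filter.Eventually.of_forall fun p => ?_)).trans (integral_im hi)
  simp [coe_testSchwartz]

/-- A function that is integrable against all Schwartz functions is locally integrable. -/
theorem locallyIntegrable_of_integrable_schwartz_mul {w : ℝ × ℝ → ℂ}
    (hw : ∀ φ : 𝓢(ℝ × ℝ, ℂ), Integrable fun p => φ p * w p) : LocallyIntegrable w := by
  intro x
  let b : ContDiffBump x := ⟨1, 2, one_pos, one_lt_two⟩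
  refine ⟨Metric.closedBall x 1, Metric.closedBall_mem_nhds x one_pos, ?_⟩
  refine ((hw (testSchwartz b.contDiff b.hasCompactSupport)).integrableOn).congr_fun
    (fun p hp => ?_) measurableSet_closedBall
  simp only [coe_testSchwartz, b.one_of_mem_closedBall hp, Complex.ofReal_one, one_mul]

/-- The weak Fourier transform is unique almost everywhere. -/
theorem IsFourierDensity.ae_eq {χ w w' : ℝ × ℝ → ℂ} (hw : IsFourierDensity χ w)
    (hw' : IsFourierDensity χ w') (hi : LocallyIntegrable w) (hi' : LocallyIntegrable w') :
    ∀ᵐ p, w p = w' p := by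
  refine ae_eq_of_integral_contDiff_smul_eq hi hi' fun φ hφ hc => ?_
  have h := (hw (testSchwartz hφ hc)).trans (hw' (testSchwartz hφ hc)).symm
  simpa only [coe_testSchwartz, Complex.real_smul] using h

/-- Interpolation between `L²` and `L^∞`, from `|w|^p ≤ C^(p-2) |w|²`. -/
theorem memLp_of_memLp_two_of_bound {w : ℝ × ℝ → ℝ} (hw : MemLp w 2) {C : ℝ}
    (hC : ∀ᵐ p, ‖w p‖ ≤ C) {p : ℝ≥0∞} (hp : 2 ≤ p) : MemLp w p := by
  rcases eq_or_ne p ⊤ with rfl | hpt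
  · exact memLp_top_of_bound hw.1 C hC
  have hp0 : p ≠ 0 := (lt_of_lt_of_le (by norm_num) hp).ne'
  have hr : 2 ≤ p.toReal := by
    rw [← ENNReal.toReal_ofNat 2]
    exact ENNReal.toReal_mono hpt hp
  rw [← integrable_norm_rpow_iff hw.1 hp0 hpt]
  refine (((memLp_two_iff_integrable_sq_norm hw.1).1 hw).const_mul (C ^ (p.toReal - 2))).mono'
    (hw.1.norm.aemeasurable.pow_const _).aestronglyMeasurable ?_
  filter_upwards [hC] with z hz
  rw [Real.norm_of_nonneg (by positivity)]
  calc ‖w z‖ ^ p.toReal = ‖w z‖ ^ (p.toReal - 2) * ‖w z‖ ^ 2 := by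
        rw [← Real.rpow_natCast ‖w z‖ 2, ← Real.rpow_add_of_nonneg (norm_nonneg _) (by linarith)
          (by norm_num)]
        norm_num
    _ ≤ C ^ (p.toReal - 2) * ‖w z‖ ^ 2 :=
        mul_le_mul_of_nonneg_right (Real.rpow_le_rpow (norm_nonneg _) hz (by linarith))
          (by positivity)

theorem contDiff_fderiv_apply {φ : ℝ × ℝ → ℝ} (hφ : ContDiff ℝ ((⊤ : ℕ∞) : WithTop ℕ∞) φ)
    (v : ℝ × ℝ) : ContDiff ℝ ((⊤ : ℕ∞) : WithTop ℕ∞) fun z => fderiv ℝ φ z v :=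
  (hφ.fderiv_right (by simp)).clm_apply contDiff_const

/-- Integration by parts: a directional derivative becomes multiplication by `i q·v`. -/
theorem invFourier_fderiv {φ : ℝ × ℝ → ℝ} (hφ : ContDiff ℝ ((⊤ : ℕ∞) : WithTop ℕ∞) φ)
    (hc : HasCompactSupport φ) (v q : ℝ × ℝ) :
    invFourier (fun p => ((fderiv ℝ φ p v : ℝ) : ℂ)) q =
      Complex.I * ((q.1 * v.1 + q.2 * v.2 : ℝ) : ℂ) * invFourier (fun p => (φ p : ℂ)) q := by
  let e : ℝ × ℝ → ℂ := fun p => Complex.exp (-(Complex.I * ((q.1 * p.1 + q.2 * p.2 : ℝ) : ℂ)))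
  have hφd : Differentiable ℝ φ := hφ.differentiable (by simp)
  have hl : ∀ p, HasFDerivAt e (e p • -(Complex.I • Complex.ofRealCLM.comp
      (q.1 • ContinuousLinearMap.fst ℝ ℝ ℝ + q.2 • ContinuousLinearMap.snd ℝ ℝ ℝ))) p := fun p =>
    ((Complex.ofRealCLM.comp (q.1 • ContinuousLinearMap.fst ℝ ℝ ℝ +
      q.2 • ContinuousLinearMap.snd ℝ ℝ ℝ)).hasFDerivAt.const_smul Complex.I).neg.cexp
  have hev : ∀ p, fderiv ℝ e p v = -(Complex.I * ((q.1 * v.1 + q.2 * v.2 : ℝ) : ℂ)) * e p := fun p => by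
    rw [(hl p).fderiv]
    simp
    ring
  have hec : Continuous e := by simp only [e]; fun_prop
  have hφv : ∀ p, fderiv ℝ (fun p => (φ p : ℂ)) p v = ((fderiv ℝ φ p v : ℝ) : ℂ) := fun p => by
    have h := ((Complex.ofRealCLM.hasFDerivAt).comp p (hφd p).hasFDerivAt).fderiv
    exact congrArg (fun L : ℝ × ℝ →L[ℝ] ℂ => L v) h
  have hcC : HasCompactSupport fun p => (φ p : ℂ) :=
    hc.comp_left (g := ((↑) : ℝ → ℂ)) Complex.ofReal_zero
  have hdC : HasCompactSupport fun p => ((fderiv ℝ φ p v : ℝ) : ℂ) :=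
    (hc.fderiv_apply (𝕜 := ℝ) v).comp_left (g := ((↑) : ℝ → ℂ)) Complex.ofReal_zero
  have hi : Integrable fun p => (φ p : ℂ) * e p :=
    ((Complex.continuous_ofReal.comp hφ.continuous).mul hec).integrable_of_hasCompactSupport
      hcC.mul_right
  have key := integral_mul_fderiv_eq_neg_fderiv_mul_of_integrable (μ := (volume : Measure (ℝ × ℝ)))
    (f := e) (g := fun p => (φ p : ℂ)) (v := v) ?_ ?_ ?_ (fun p _ => (hl p).differentiableAt)
    (fun p _ => (Complex.ofRealCLM.differentiableAt).comp p (hφd p))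
  · simp only [hφv, hev] at key
    rw [invFourier, invFourier, mul_left_comm, ← integral_const_mul (Complex.I * _)]
    congr 1
    rw [← integral_neg] at key
    refine Eq.trans ?_ (key.trans ?_)
    · congr 1; ext p; exact mul_comm _ _
    · congr 1; ext p; simp only [e]; ring
  · simp only [hev]
    refine (hi.const_mul (-(Complex.I * ((q.1 * v.1 + q.2 * v.2 : ℝ) : ℂ)))).congr
      (Filter.Eventually.of_forall fun p => ?_)
    simp only; ring
  · simp only [hφv]
    exact (hec.mul (Complex.continuous_ofReal.comp
      (contDiff_fderiv_apply hφ v).continuous)).integrable_of_hasCompactSupport hdC.mul_left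
  · simpa only [mul_comm] using hi

theorem iterate_fderiv_apply {φ : ℝ × ℝ → ℝ} (hφ : ContDiff ℝ ((⊤ : ℕ∞) : WithTop ℕ∞) φ)
    (hc : HasCompactSupport φ) (v : ℝ × ℝ) (n : ℕ) :
    ContDiff ℝ ((⊤ : ℕ∞) : WithTop ℕ∞)
        ((fun (ψ : ℝ × ℝ → ℝ) (z : ℝ × ℝ) => fderiv ℝ ψ z v)^[n] φ) ∧
      HasCompactSupport ((fun (ψ : ℝ × ℝ → ℝ) (z : ℝ × ℝ) => fderiv ℝ ψ z v)^[n] φ) ∧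
      ∀ q, invFourier (fun p => (((fun (ψ : ℝ × ℝ → ℝ) (z : ℝ × ℝ) => fderiv ℝ ψ z v)^[n] φ p : ℝ)
          : ℂ)) q =
        (Complex.I * ((q.1 * v.1 + q.2 * v.2 : ℝ) : ℂ)) ^ n *
          invFourier (fun p => (φ p : ℂ)) q := by
  induction n with
  | zero => exact ⟨hφ, hc, fun q => by rw [pow_zero, one_mul]; rfl⟩
  | succ n ih =>
    obtain ⟨h1, h2, h3⟩ := ih
    rw [Function.iterate_succ_apply']
    refine ⟨contDiff_fderiv_apply h1 v, h2.fderiv_apply (𝕜 := ℝ) v, fun q => ?_⟩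
    rw [invFourier_fderiv h1 h2, h3, pow_succ']
    ring

theorem invFourier_partialDeriv {φ : ℝ × ℝ → ℝ} (hφ : ContDiff ℝ ((⊤ : ℕ∞) : WithTop ℕ∞) φ)
    (hc : HasCompactSupport φ) (a b : ℕ) :
    ContDiff ℝ ((⊤ : ℕ∞) : WithTop ℕ∞) (partialDeriv a b φ) ∧
      HasCompactSupport (partialDeriv a b φ) ∧
      ∀ q, invFourier (fun p => (partialDeriv a b φ p : ℂ)) q =
        Complex.I ^ (a + b) * ((q.1 : ℂ) ^ a * ((q.2 : ℂ) ^ b *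
          invFourier (fun p => (φ p : ℂ)) q)) := by
  obtain ⟨h1, h2, h3⟩ := iterate_fderiv_apply hφ hc (0, 1) b
  obtain ⟨h4, h5, h6⟩ := iterate_fderiv_apply h1 h2 (1, 0) a
  refine ⟨h4, h5, fun q => (h6 q).trans ?_⟩
  rw [h3]
  simp only [mul_zero, mul_one, zero_add, add_zero, mul_pow, pow_add]
  ring

/-- Multiplying `χ` by `u^a v^b` differentiates its Fourier transform. -/
theorem isWeakDeriv_of_isFourierDensity {χ w' : ℝ × ℝ → ℂ} {w : ℝ × ℝ → ℝ} {a b : ℕ}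
    (hw : IsFourierDensity χ fun p => (w p : ℂ))
    (hw' : IsFourierDensity (fun q => (q.1 : ℂ) ^ a * ((q.2 : ℂ) ^ b * χ q)) w')
    (h2 : MemLp w' 2) :
    IsWeakDeriv a b w fun p => (-1) ^ (a + b) * (Complex.I ^ (a + b) * w' p).re := by
  intro φ hφ hc
  obtain ⟨h1, h3, h4⟩ := invFourier_partialDeriv hφ hc a b
  have e1 := hw (testSchwartz h1 h3)
  have e2 := hw' (testSchwartz hφ hc)
  simp only [coe_testSchwartz] at e1 e2
  have h5 : ∫ p, (partialDeriv a b φ p : ℂ) * (w p : ℂ) =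
      ∫ p, (φ p : ℂ) * (Complex.I ^ (a + b) * w' p) := by
    simp only [mul_left_comm _ (Complex.I ^ (a + b)), integral_const_mul]
    rw [e1, e2, mul_left_comm, ← integral_const_mul (Complex.I ^ (a + b))]
    congr 2; ext q
    rw [h4]; ring
  have hi : Integrable fun p => (φ p : ℂ) * (Complex.I ^ (a + b) * w' p) :=
    schwartz_mul_integrable (testSchwartz hφ hc) (h2.const_mul _)
  have h6 : ∫ p, w p * partialDeriv a b φ p = ∫ p, φ p * (Complex.I ^ (a + b) * w' p).re := by
    have h7 : ∫ p, φ p * (Complex.I ^ (a + b) * w' p).re =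
        (∫ p, (φ p : ℂ) * (Complex.I ^ (a + b) * w' p)).re := by
      refine (integral_congr_ae (Filter.Eventually.of_forall fun p => ?_)).trans (integral_re hi)
      exact (Complex.re_ofReal_mul _ _).symm
    rw [h7, ← h5]
    have h8 : ∀ p, (partialDeriv a b φ p : ℂ) * (w p : ℂ) =
        ((w p * partialDeriv a b φ p : ℝ) : ℂ) := fun p => by push_cast; ring
    simp only [h8]
    rw [integral_complex_ofReal, Complex.ofReal_re]
  rw [h6, ← integral_const_mul]
  congr 1; ext p
  have h9 : ((-1 : ℝ) ^ (a + b)) * (-1) ^ (a + b) = 1 := by rw [← mul_pow]; norm_num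
  linear_combination (-(φ p * (Complex.I ^ (a + b) * w' p).re)) * h9

/-- If all weighted functions `u^a v^b χ`, `a + b ≤ κ`, have bounded square integrable Fourier
transforms, then the Fourier transform of `χ` is Sobolev regular. -/
theorem memSobolev_of_hasBoundedDensity {χ : ℝ × ℝ → ℂ} {w : ℝ × ℝ → ℝ} {κ : ℕ}
    (hχ : ∀ a b : ℕ, a + b ≤ κ →
      HasBoundedDensity fun q => (q.1 : ℂ) ^ a * ((q.2 : ℂ) ^ b * χ q))
    (hi : LocallyIntegrable fun p => (w p : ℂ)) (hw : IsFourierDensity χ fun p => (w p : ℂ))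
    {p : ℝ≥0∞} (hp : 2 ≤ p) : MemSobolev w p κ := by
  refine ⟨?_, fun a b hab => ?_⟩
  · obtain ⟨_, w', h2, ⟨C, hC⟩, hd⟩ := hχ 0 0 (Nat.zero_le _)
    simp only [pow_zero, one_mul] at hd
    have h1 := hw.ae_eq hd hi (h2.locallyIntegrable (by norm_num))
    refine memLp_of_memLp_two_of_bound (C := C) (h2.re.ae_eq ?_) ?_ hp
    · filter_upwards [h1] with z hz
      rw [← hz]; rfl
    · filter_upwards [h1, hC] with z hz hzC
      rwa [← hz, Complex.norm_real] at hzC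
  · obtain ⟨_, w', h2, ⟨C, hC⟩, hd⟩ := hχ a b hab
    refine ⟨_, ?_, isWeakDeriv_of_isFourierDensity hw hd h2⟩
    refine memLp_of_memLp_two_of_bound (C := C) ((h2.const_mul (Complex.I ^ (a + b))).re.const_mul _)
      ?_ hp
    filter_upwards [hC] with z hz
    rw [norm_mul, norm_pow, norm_neg, norm_one, one_pow, one_mul]
    refine ((Complex.abs_re_le_norm _).trans ?_).trans hz
    rw [norm_mul, norm_pow, Complex.norm_I, one_pow, one_mul]

end Regularity

end WignerMalliavin

theorem mainTheorem1 {𝔥 : Type*} [NormedAddCommGroup 𝔥] [InnerProductSpace ℝ 𝔥] [CompleteSpace 𝔥]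
    [TopologicalSpace.SeparableSpace 𝔥] (κ : ℕ) (h : 𝔥 × 𝔥) (hh : inner ℝ h.1 h.2 ≠ 0)
    (ρ : WignerMalliavin.BddOp 𝔥) (hρ : WignerMalliavin.IsDensityMatrix ρ)
    (Φ : WignerMalliavin.BddOp 𝔥 → ℂ) (hΦ : ∀ X, Φ X = WignerMalliavin.trace (ρ * X))
    (k ℓ : WignerMalliavin.Cplx 𝔥 × WignerMalliavin.Cplx 𝔥)
    (hdet : Matrix.det
      !![inner ℂ (WignerMalliavin.Cplx.ofReal h.1) k.1, inner ℂ (WignerMalliavin.Cplx.ofReal h.2) k.2;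
        inner ℂ (WignerMalliavin.Cplx.ofReal h.1) ℓ.1, inner ℂ (WignerMalliavin.Cplx.ofReal h.2) ℓ.2] ≠ 0)
    (hD : ∀ κ₁ κ₂ : ℕ, κ₁ + κ₂ ≤ κ → ∃ B A : WignerMalliavin.BddOp 𝔥,
      WignerMalliavin.IsIterFrechetDeriv ℓ κ₂ ρ B ∧ WignerMalliavin.IsIterFrechetDeriv k κ₁ B A ∧
        WignerMalliavin.traceAbs A < ⊤) :
    (∃ w : ℝ × ℝ → ℝ, WignerMalliavin.IsWignerDensity h Φ w) ∧
      ∀ w : ℝ × ℝ → ℝ, WignerMalliavin.IsWignerDensity h Φ w →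
        ∀ p : ENNReal, 2 ≤ p → WignerMalliavin.MemSobolev w p κ := by
  obtain ⟨hpos, htr, -⟩ := hρ
  have hfac := fun a b hab => WignerMalliavin.hasBoundedDensity_coord_pow hdet
    (fun m n hmn => WignerMalliavin.hasBoundedDensity_symbol_pow hh hD hmn) a b 0 0 hab
  simp only [pow_zero, one_mul, add_zero] at hfac
  simp only [WignerMalliavin.isWignerDensity_iff htr hΦ]
  refine ⟨?_, fun w hw p hp => WignerMalliavin.memSobolev_of_hasBoundedDensity hfac
    (WignerMalliavin.locallyIntegrable_of_integrable_schwartz_mul hw.1) hw.2 hp⟩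
  obtain ⟨_, w, h2, -, hw⟩ := WignerMalliavin.hasBoundedDensity_charFn hh htr
  obtain ⟨_, _, _, _, hN⟩ := WignerMalliavin.exists_isNuclear htr
  -- `ρ` is self-adjoint, so its characteristic function is Hermitian and the density real
  have him := hw.ae_im_eq_zero h2
    ((WignerMalliavin.isWeylSystem_weylFamily h).charFn_neg hN hpos.isSelfAdjoint)
  have hre : ∀ φ : SchwartzMap (ℝ × ℝ) ℂ, (fun p => φ p * w p) =ᵐ[MeasureTheory.volume]
      fun p => φ p * ((w p).re : ℂ) := fun φ => by
    filter_upwards [him] with z hz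
    rw [(Complex.ext rfl hz : w z = ((w z).re : ℂ)), Complex.ofReal_re]
  exact ⟨fun p => (w p).re,
    fun φ => (WignerMalliavin.schwartz_mul_integrable φ h2).congr (hre φ),
    fun φ => (MeasureTheory.integral_congr_ae (hre φ)).symm.trans (hw φ)⟩
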